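/- Setting. Let $\Phi\colon\mathbb R^2\to\mathbb R^2$ be a $C^1$ diffeomorphism and let $\widehat C_0,\widehat C_1,\widehat C_2\subset[0,1]^2$ be pairwise disjoint closed rectangles with sides parallel to the axes, such that on each $\widehat C_i$ the map $\Phi$ is affine with linear part $\operatorname{diag}(a_i,b_i)$, $0<|a_i|<1<|b_i|$, and such that the maximal invariant set $\Gamma=\{\widehat x:\Phi^n(\widehat x)\in\widehat C_0\cup\widehat C_1\cup\widehat C_2\ \text{for all } n\in\mathbb Z\}$ is a horseshoe conjugate to the full shift on $\{0,1,2\}^{\mathbb Z}$ through a homeomorphism $\varpi\colon\Gamma\to\{0,1,2\}^{\mathbb Z}$ with $\Phi^n(\widehat x)\in\widehat C_{\varpi(\widehat x)_n}$ for all $n\in\mathbb Z$. Let $f_0,f_1,f_2\colon[0,1]\to[0,1]$ be $C^1$ injective maps with $|a_i|<|f_j'(x)|<|b_i|$ for all $i,j\in\{0,1,2\}$ and $x\in[0,1]$, and assume, for some $\gamma\in(0,1)$: (F0) $f_0$ is increasing and has exactly two fixed points, $0$ (repelling) and $1$ (attracting), with $\beta_0=f_0'(0)>1$, $\lambda_0=f_0'(1)\in(0,1)$,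 and $\lambda_0\le f_0'(x)$ for all $x\in[0,1]$. (F1) $f_1(x)=\gamma(1-x)$, with $\gamma\ge\lambda_0$. (F2) $f_2$ is increasing, $f_2(0)=0$, $\beta_2=f_2'(0)>1$, and $f_2$ has an attracting fixed point $p_2\in(0,1)$ with $f_2'(p_2)<1$. (F01) $f_0'$ is non-increasing on $[0,1]$ and $\gamma\,\dfrac{\lambda_0^3(1-\lambda_0)}{1-\beta_0^{-1}}>1$. (D) $f_0'(x),f_2'(x)\le\beta_{02}^+$ for all $x\in[0,1]$, where $\beta_{02}^+=\max\{\beta_0,\beta_2\}$. Let $F(\widehat x,x)=(\Phi(\widehat x),f_i(x))$ for $(\widehat x,x)\in\widehat C_i\times[0,1]$, let $\Lambda$ be the maximal invariant set of $F$ (the set of points that have a full $F$-orbit, forward and backward, in $\bigcup_i\widehat C_i\times[0,1]$), and let $E^c$ be the direction of the fibers $\{\widehat x\}\times[0,1]$. For an $F$-invariant Borel probability measure $\mu$ on $\Lambda$ let $h_\mu(F)$ be its Kolmogorov–Sinai entropy and $\chi_c(\mu)=\int_\Lambda\log\|dF|_{E^c}\|\,d\mu$ its central Lyapunov exponent. A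 measure of maximal entropy is an equilibrium state of the zero potential, that is, an $F$-invariant Borel probability measure on $\Lambda$ whose entropy is maximal among all such measures. Claim. If $\gamma\,(\beta_{02}^+)^2<1$, then $F|_\Lambda$ has a measure of maximal entropy, it is unique, and its central Lyapunov exponent is negative. -/

import Mathlib

open Set Filter MeasureTheory

noncomputable section

/-! ### Kolmogorov–Sinai entropy -/

section Entropy

variable {X : Type*} [MeasurableSpace X]

/-- Shannon entropy of the partition of `X` into the sets of points with the same
`P`-itinerary of length `n` under `T`, that is, of `P ∨ T⁻¹P ∨ … ∨ T^{-(n-1)}P`.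
A finite partition with at most `k` atoms is given by its labelling `P : X → Fin k`. -/
def itineraryEntropy (μ : Measure X) (T : X → X) {k : ℕ} (P : X → Fin k) (n : ℕ) : ℝ :=
  ∑ w : Fin n → Fin k, Real.negMulLog (μ.real {x | ∀ j : Fin n, P (T^[(j : ℕ)] x) = w j})

/-- Entropy of `T` with respect to the finite partition `P`. -/
def partitionEntropy (μ : Measure X) (T : X → X) {k : ℕ} (P : X → Fin k) : EReal :=
  limsup (fun n : ℕ => ((itineraryEntropy μ T P n / n : ℝ) : EReal)) atTop

/-- Kolmogorov–Sinai (measure-theoretic) entropy: the supremum of the entropies over all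
finite measurable partitions. -/
def measureEntropy (μ : Measure X) (T : X → X) : EReal :=
  ⨆ (k : ℕ) (P : X → Fin k) (_ : Measurable P), partitionEntropy μ T P

/-- `μ` is a `T`-invariant probability measure. -/
def IsInvariantProbability (T : X → X) (μ : Measure X) : Prop :=
  IsProbabilityMeasure μ ∧ MeasurePreserving T μ μ

/-- `ν` is an equilibrium state of the (continuous) potential `φ` with respect to `T`: it
maximizes `h_μ(T) + ∫ φ dμ` among all `T`-invariant probability measures `μ`. -/
def IsEquilibriumState (T : X → X) (φ : X → ℝ) (ν : Measure X) : Prop :=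
  IsInvariantProbability T ν ∧ ∀ μ : Measure X, IsInvariantProbability T μ →
    measureEntropy μ T + ((∫ x, φ x ∂μ : ℝ) : EReal) ≤
      measureEntropy ν T + ((∫ x, φ x ∂ν : ℝ) : EReal)

/-- A measure of maximal entropy is an equilibrium state of the zero potential. -/
def IsMeasureOfMaximalEntropy (T : X → X) (ν : Measure X) : Prop :=
  IsEquilibriumState T (fun _ => 0) ν

end Entropy

/-! ### The planar horseshoe -/

/-- The set of points whose full `Φ`-orbit stays in the union of the sets `C i`. -/
def horseshoeSet (Φ : Equiv.Perm (ℝ × ℝ)) (C : Fin 3 → Set (ℝ × ℝ)) : Set (ℝ × ℝ) :=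
  {x | ∀ n : ℤ, (Φ ^ n) x ∈ ⋃ i, C i}

/-- A diffeomorphism `Φ` of the plane with a three-legged affine horseshoe in the unit square.
The first coordinate is the strong stable direction, the second one the strong unstable one. -/
structure AffineHorseshoe where
  /-- the planar diffeomorphism -/
  Φ : Equiv.Perm (ℝ × ℝ)
  contDiff_Φ : ContDiff ℝ 1 Φ
  contDiff_Φ_symm : ContDiff ℝ 1 Φ.symm
  /-- lower left corners of the sub-rectangles -/
  lo : Fin 3 → ℝ × ℝ
  /-- upper right corners of the sub-rectangles -/
  hi : Fin 3 → ℝ × ℝ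
  leg_subset : ∀ i, Icc (lo i) (hi i) ⊆ Icc (0, 0) (1, 1)
  leg_disjoint : ∀ i j, i ≠ j → Disjoint (Icc (lo i) (hi i)) (Icc (lo j) (hi j))
  /-- contraction factors (with sign) -/
  a : Fin 3 → ℝ
  /-- expansion factors (with sign) -/
  b : Fin 3 → ℝ
  /-- translation parts -/
  c : Fin 3 → ℝ × ℝ
  affine : ∀ i, ∀ x ∈ Icc (lo i) (hi i), Φ x = (a i * x.1 + (c i).1, b i * x.2 + (c i).2)
  contracting : ∀ i, 0 < |a i| ∧ |a i| < 1
  expanding : ∀ i, 1 < |b i|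
  /-- the conjugation of the horseshoe with the full shift on three symbols -/
  ϖ : horseshoeSet Φ (fun i => Icc (lo i) (hi i)) ≃ₜ (ℤ → Fin 3)
  /-- `ϖ` records the rectangles visited by the orbit; hence it conjugates `Φ` to the shift, and
  the `i`-th rectangle meets the horseshoe in the points whose symbol at time `0` is `i` -/
  coding : ∀ x (n : ℤ), (Φ ^ n) (x : ℝ × ℝ) ∈ Icc (lo (ϖ x n)) (hi (ϖ x n))

namespace AffineHorseshoe

/-- The sub-rectangles of the unit square. -/
def leg (S : AffineHorseshoe) (i : Fin 3) : Set (ℝ × ℝ) := Icc (S.lo i) (S.hi i)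

open Classical in
/-- The index of the sub-rectangle that contains a given point of their union. -/
def symbol (S : AffineHorseshoe) (x : ℝ × ℝ) : Fin 3 :=
  if x ∈ S.leg 0 then 0 else if x ∈ S.leg 1 then 1 else 2

end AffineHorseshoe

/-! ### The fiber maps -/

/-- Derivative of the `i`-th fiber map on `[0,1]` (one-sided at the end points). -/
def fiberDeriv (f : Fin 3 → ℝ → ℝ) (i : Fin 3) (x : ℝ) : ℝ := derivWithin (f i) (Icc 0 1) x

/-- `β₀ = f₀'(0)`. -/
def beta0 (f : Fin 3 → ℝ → ℝ) : ℝ := fiberDeriv f 0 0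

/-- `λ₀ = f₀'(1)`. -/
def lambda0 (f : Fin 3 → ℝ → ℝ) : ℝ := fiberDeriv f 0 1

/-- `β₂ = f₂'(0)`. -/
def beta2 (f : Fin 3 → ℝ → ℝ) : ℝ := fiberDeriv f 2 0

/-- `β₀₂⁺ = max {β₀, β₂}`. -/
def betaPlus (f : Fin 3 → ℝ → ℝ) : ℝ := max (beta0 f) (beta2 f)

/-- `f₀` is increasing, has exactly two fixed points, `0` (repelling) and `1` (attracting), and
`f₀'` is bounded from below by `λ₀`. -/
structure CondF0 (f : Fin 3 → ℝ → ℝ) : Prop where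
  strictMono : StrictMonoOn (f 0) (Icc 0 1)
  fixed_iff : ∀ x ∈ Icc (0 : ℝ) 1, f 0 x = x ↔ x = 0 ∨ x = 1
  repelling : 1 < beta0 f
  attracting : 0 < lambda0 f ∧ lambda0 f < 1
  lambda0_le : ∀ x ∈ Icc (0 : ℝ) 1, lambda0 f ≤ fiberDeriv f 0 x

/-- `f₁(x) = γ (1 - x)` is an affine contraction, and `γ ≥ λ₀`. -/
structure CondF1 (f : Fin 3 → ℝ → ℝ) (γ : ℝ) : Prop where
  eq : ∀ x ∈ Icc (0 : ℝ) 1, f 1 x = γ * (1 - x)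
  pos : 0 < γ
  lt_one : γ < 1
  lambda0_le : lambda0 f ≤ γ

/-- `f₂` is increasing and has two hyperbolic fixed points, `0` (repelling) and
`p₂ ∈ (0,1)` (attracting). -/
structure CondF2 (f : Fin 3 → ℝ → ℝ) : Prop where
  strictMono : StrictMonoOn (f 2) (Icc 0 1)
  fixed_zero : f 2 0 = 0
  repelling : 1 < beta2 f
  attracting : ∃ p ∈ Ioo (0 : ℝ) 1, f 2 p = p ∧ fiberDeriv f 2 p < 1

/-- `f₀'` is decreasing and `γ λ₀³ (1 - λ₀) / (1 - β₀⁻¹) > 1`. -/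
structure CondF01 (f : Fin 3 → ℝ → ℝ) (γ : ℝ) : Prop where
  antitone : AntitoneOn (fiberDeriv f 0) (Icc 0 1)
  expanding : 1 < γ * (lambda0 f ^ 3 * (1 - lambda0 f) / (1 - (beta0 f)⁻¹))

/-- `f₀', f₂' ≤ β₀₂⁺` on `[0,1]`. -/
structure CondDerivBound (f : Fin 3 → ℝ → ℝ) : Prop where
  zero_le : ∀ x ∈ Icc (0 : ℝ) 1, fiberDeriv f 0 x ≤ betaPlus f
  two_le : ∀ x ∈ Icc (0 : ℝ) 1, fiberDeriv f 2 x ≤ betaPlus f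

/-! ### The skew product -/

/-- A skew product of `C¹` injective maps of `[0,1]` over an affine horseshoe whose contraction
and expansion are stronger than those of the fiber maps. -/
structure HorseshoeSkewProduct extends AffineHorseshoe where
  /-- the fiber maps -/
  f : Fin 3 → ℝ → ℝ
  mapsTo : ∀ i, MapsTo (f i) (Icc 0 1) (Icc 0 1)
  contDiffOn : ∀ i, ContDiffOn ℝ 1 (f i) (Icc 0 1)
  injOn : ∀ i, InjOn (f i) (Icc 0 1)
  dominated : ∀ i j, ∀ x ∈ Icc (0 : ℝ) 1, |a i| < |fiberDeriv f j x| ∧ |fiberDeriv f j x| < |b i|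

namespace HorseshoeSkewProduct

variable (S : HorseshoeSkewProduct)

/-- The region where `F` is defined: the union of the sub-cubes `leg i × [0,1]`. -/
def domain : Set ((ℝ × ℝ) × ℝ) := ⋃ i, S.leg i ×ˢ Icc (0 : ℝ) 1

/-- `F(x̂, x) = (Φ(x̂), f_i(x))` for `x̂` in the `i`-th sub-rectangle (only the values on `domain`
are ever used). -/
def F (R : (ℝ × ℝ) × ℝ) : (ℝ × ℝ) × ℝ := (S.Φ R.1, S.f (S.symbol R.1) R.2)

/-- The maximal invariant set of `F` in the cube: the points with a full `F`-orbit in it. -/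
def Λ : Set ((ℝ × ℝ) × ℝ) :=
  {R | ∃ z : ℤ → (ℝ × ℝ) × ℝ, z 0 = R ∧ ∀ n, z n ∈ S.domain ∧ S.F (z n) = z (n + 1)}

theorem mapsTo_F : MapsTo S.F S.Λ S.Λ := by
  rintro R ⟨z, rfl, hz⟩
  refine ⟨fun n => z (n + 1), ?_, fun n => hz (n + 1)⟩
  simpa using (hz 0).2.symm

/-- The restriction `F|Λ : Λ → Λ`. -/
def FΛ : S.Λ → S.Λ := S.mapsTo_F.restrict

/-- `‖dF|E^c‖`, where `E^c` is the direction of the fiber `{x̂} × [0,1]`. -/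
def centralNorm (R : (ℝ × ℝ) × ℝ) : ℝ :=
  ‖derivWithin (fun t : ℝ => S.F (R.1, t)) (Icc 0 1) R.2‖

/-- The central Lyapunov exponent `χ_c(μ) = ∫ log ‖dF|E^c‖ dμ`. -/
def centralExponent (μ : Measure S.Λ) : ℝ :=
  ∫ R : S.Λ, Real.log (S.centralNorm (R : (ℝ × ℝ) × ℝ)) ∂μ

end HorseshoeSkewProduct

end

/-! Recording symbols sends F|Λ equivariantly to the full shift on three symbols. The fiber maps are
monotone, so the fibers carry no entropy: over a fixed word of n symbols the pattern of visits to
{height < q} has at most n + 1 possibilities (`below_iff_of_belowCount_eq`), and log(n + 1) = o(n).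
The sets of zero entropy relative to the symbol partition form a σ-algebra (`relPinsker`), which
therefore contains every measurable subset of Λ. Hence h_μ(F) ≤ H_m / m for each m ≥ 1, with H_m the
entropy of the m-symbol words (`measureEntropy_le_itinerary`). So h_μ(F) ≤ log 3, and equality makes
all words of each length equally likely: μ projects to the uniform Bernoulli measure
(`map_code_eq_bernoulliThree`).

It remains to see that the Bernoulli measure has exactly one lift to Λ, and that this lift is
invariant. The fiber maps have Lipschitz constants β₀₂⁺, γ, β₀₂⁺, whose mean logarithm is log(γ
(β₀₂⁺)²) / 3 < 0. By the strong law of large numbers their products along the past of almost every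
sequence tend to 0, so the fiber of Λ over that sequence is one point (`tendsto_branch`,
`height_eq_fiberPoint`). Pushing the Bernoulli measure along this measurable section gives a lift,
and every lift lives on the same graph (`exists_invariant_lift`,
`eq_of_map_code_eq_bernoulliThree`). Integrating the same derivative bounds gives the sign of the
exponent (`centralExponent_neg`). -/

/-! ### Shannon entropy of finite-valued measurable maps -/

section ShannonEntropy

set_option linter.unusedSectionVars false

variable {X α β δ : Type*} [MeasurableSpace X]
  [Fintype α] [MeasurableSpace α] [MeasurableSingletonClass α]
  [Fintype β] [MeasurableSpace β] [MeasurableSingletonClass β]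
  [Fintype δ] [MeasurableSpace δ] [MeasurableSingletonClass δ]

/-- Shannon entropy of the partition into the level sets of `A`. -/
noncomputable def shannonEntropy {α : Type*} [Fintype α] (μ : Measure X) (A : X → α) : ℝ :=
  ∑ a, Real.negMulLog (μ.real (A ⁻¹' {a}))

/-- Conditional Shannon entropy of `A` given `B`. -/
noncomputable def condShannonEntropy {α β : Type*} [Fintype α] [Fintype β] (μ : Measure X)
    (A : X → α) (B : X → β) : ℝ :=
  shannonEntropy μ (fun x => (A x, B x)) - shannonEntropy μ B

variable {μ : Measure X} [IsProbabilityMeasure μ] {A : X → α} {B : X → β} {D : X → δ}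

theorem measureReal_preimage_eq_sum [DecidableEq β] (φ : α → β)
    (hA : Measurable A) (b : β) :
    μ.real ((φ ∘ A) ⁻¹' {b}) = ∑ a with φ a = b, μ.real (A ⁻¹' {a}) := by
  rw [← measureReal_biUnion_finset]
  · congr 1
    ext x
    simp
  · intro a _ a' _ haa'
    exact Disjoint.preimage A (by simpa using haa')
  · exact fun a _ => hA (measurableSet_singleton a)

/-- The left side splits into terms -p_i log(∑ p); since p_i ≤ ∑ p, monotonicity of log compares
them one by one. -/
theorem negMulLog_sum_le {ι : Type*} (s : Finset ι) (p : ι → ℝ) (hp : ∀ i ∈ s, 0 ≤ p i) :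
    Real.negMulLog (∑ i ∈ s, p i) ≤ ∑ i ∈ s, Real.negMulLog (p i) := by
  have : Real.negMulLog (∑ i ∈ s, p i) = ∑ i ∈ s, -(p i) * Real.log (∑ i ∈ s, p i) := by
    rw [← Finset.sum_mul, Real.negMulLog, Finset.sum_neg_distrib]
  rw [this]
  refine Finset.sum_le_sum fun i hi => ?_
  rcases (hp i hi).eq_or_lt with h | h
  · simp [← h]
  · have := Real.log_le_log h (Finset.single_le_sum hp hi)
    rw [Real.negMulLog]
    nlinarith

theorem shannonEntropy_comp_le (φ : α → β) (hA : Measurable A) :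
    shannonEntropy μ (φ ∘ A) ≤ shannonEntropy μ A := by
  classical
  unfold shannonEntropy
  rw [← Finset.sum_fiberwise (s := Finset.univ) (g := φ)]
  refine Finset.sum_le_sum fun b _ => ?_
  rw [measureReal_preimage_eq_sum φ hA b]
  exact negMulLog_sum_le _ _ fun _ _ => measureReal_nonneg

/-- A coarser partition has smaller entropy. -/
theorem shannonEntropy_le_of_factor (hA : Measurable A)
    (h : ∀ x y, A x = A y → B x = B y) : shannonEntropy μ B ≤ shannonEntropy μ A := by
  have hX : Nonempty X := nonempty_of_isProbabilityMeasure μ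
  obtain ⟨x₀⟩ := hX
  have : Nonempty β := ⟨B x₀⟩
  have hBA : Function.FactorsThrough B A := fun x y hxy => h x y hxy
  obtain ⟨φ, hφ⟩ := (Function.factorsThrough_iff B).1 hBA
  rw [hφ]
  exact shannonEntropy_comp_le φ hA

theorem shannonEntropy_eq_of_factor (hA : Measurable A) (hB : Measurable B)
    (h : ∀ x y, A x = A y ↔ B x = B y) : shannonEntropy μ A = shannonEntropy μ B :=
  le_antisymm (shannonEntropy_le_of_factor hB fun x y => (h x y).2)
    (shannonEntropy_le_of_factor hA fun x y => (h x y).1)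

theorem sum_measureReal_preimage (hA : Measurable A) : ∑ a, μ.real (A ⁻¹' {a}) = 1 := by
  have := measureReal_preimage_eq_sum (μ := μ) (fun _ : α => ()) hA ()
  have h1 : ((fun _ : α => ()) ∘ A) ⁻¹' {()} = univ := by ext; simp
  rw [h1, probReal_univ] at this
  simpa using this.symm

/-- Gibbs' inequality for one term: log t ≤ t - 1 at t = 1/(pK), multiplied by p. With K the number
of atoms, the right sides sum to 0 over a probability vector. -/
theorem mul_log_div_card_le {K p : ℝ} (hK : 0 < K) (hp : 0 ≤ p) :
    Real.negMulLog p - p * Real.log K ≤ 1 / K - p := by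
  rcases hp.eq_or_lt with rfl | hp
  · simp [hK.le]
  · have h1 : Real.log (1 / (p * K)) ≤ 1 / (p * K) - 1 := Real.log_le_sub_one_of_pos (by positivity)
    have h2 : Real.log (1 / (p * K)) = -Real.log p - Real.log K := by
      rw [one_div, Real.log_inv, Real.log_mul hp.ne' hK.ne']; ring
    rw [h2] at h1
    have h3 := mul_le_mul_of_nonneg_left h1 hp.le
    have h4 : p * (1 / (p * K) - 1) = 1 / K - p := by field_simp
    rw [Real.negMulLog]
    linarith

/-- The inequality log t < t - 1 is strict for t ≠ 1, so equality forces pK = 1. -/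
theorem eq_inv_of_mul_log_div_card_eq {K p : ℝ} (hK : 0 < K) (hp : 0 ≤ p)
    (h : Real.negMulLog p - p * Real.log K = 1 / K - p) : p = 1 / K := by
  rcases hp.eq_or_lt with rfl | hp
  · simp at h
    exact absurd h hK.ne
  · by_contra hne
    have h1 : Real.log (1 / (p * K)) < 1 / (p * K) - 1 := by
      refine Real.log_lt_sub_one_of_pos (by positivity) fun h1 => hne ?_
      field_simp at h1 ⊢
      linarith
    have h2 : Real.log (1 / (p * K)) = -Real.log p - Real.log K := by
      rw [one_div, Real.log_inv, Real.log_mul hp.ne' hK.ne']; ring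
    rw [h2] at h1
    have h3 := mul_lt_mul_of_pos_left h1 hp
    have h4 : p * (1 / (p * K) - 1) = 1 / K - p := by field_simp
    rw [Real.negMulLog] at h
    linarith

theorem shannonEntropy_sub_log_card (hA : Measurable A) :
    shannonEntropy μ A - Real.log (Fintype.card α) =
      ∑ a, (Real.negMulLog (μ.real (A ⁻¹' {a})) -
        μ.real (A ⁻¹' {a}) * Real.log (Fintype.card α)) := by
  rw [Finset.sum_sub_distrib, ← Finset.sum_mul, sum_measureReal_preimage hA, one_mul,
    shannonEntropy]

theorem card_pos_of_measurable (μ : Measure X) [IsProbabilityMeasure μ] (A : X → α) :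
    (0 : ℝ) < Fintype.card α := by
  obtain ⟨x₀⟩ : Nonempty X := nonempty_of_isProbabilityMeasure μ
  have : Nonempty α := ⟨A x₀⟩
  exact_mod_cast Fintype.card_pos

theorem sum_inv_card_sub (hA : Measurable A) :
    ∑ a, (1 / (Fintype.card α : ℝ) - μ.real (A ⁻¹' {a})) = 0 := by
  have := card_pos_of_measurable μ A
  rw [Finset.sum_sub_distrib, sum_measureReal_preimage hA]
  simp [this.ne']

theorem shannonEntropy_le_log_card (hA : Measurable A) :
    shannonEntropy μ A ≤ Real.log (Fintype.card α) := by
  have hK := card_pos_of_measurable μ A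
  rw [← sub_nonpos, shannonEntropy_sub_log_card hA, ← sum_inv_card_sub (μ := μ) hA]
  exact Finset.sum_le_sum fun a _ => mul_log_div_card_le hK measureReal_nonneg

/-- Only the uniform distribution has maximal entropy. -/
theorem measureReal_eq_of_log_card_le (hA : Measurable A)
    (h : Real.log (Fintype.card α) ≤ shannonEntropy μ A) (a : α) :
    μ.real (A ⁻¹' {a}) = 1 / Fintype.card α := by
  have hK := card_pos_of_measurable μ A
  have h0 := le_antisymm (shannonEntropy_le_log_card hA) h
  rw [← sub_eq_zero, shannonEntropy_sub_log_card hA, ← sum_inv_card_sub (μ := μ) hA,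
    Finset.sum_eq_sum_iff_of_le fun a _ => mul_log_div_card_le hK measureReal_nonneg] at h0
  exact eq_inv_of_mul_log_div_card_eq hK measureReal_nonneg (h0 a (Finset.mem_univ a))

theorem shannonEntropy_eq_log_card_of_uniform
    (h : ∀ a, μ.real (A ⁻¹' {a}) = 1 / Fintype.card α) :
    shannonEntropy μ A = Real.log (Fintype.card α) := by
  have hK := card_pos_of_measurable μ A
  rw [shannonEntropy]
  simp only [h]
  simp [Real.negMulLog]
  field_simp

/-- Again log t ≤ t - 1, now at t = qr/(ps): one term of the nonnegativity of conditional mutual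
information. The order hypotheses hold for marginals and make q, r, s positive once p is. -/
theorem mul_log_le_of_le {p q r s : ℝ} (hp : 0 ≤ p) (hpq : p ≤ q) (hpr : p ≤ r) (hqs : q ≤ s) :
    p * Real.log q + p * Real.log r - p * Real.log p - p * Real.log s ≤ q * r / s - p := by
  rcases hp.eq_or_lt with rfl | hp
  · simp only [zero_mul, add_zero, sub_zero]
    exact div_nonneg (mul_nonneg hpq hpr) (hpq.trans hqs)
  · have hq := hp.trans_le hpq
    have hr := hp.trans_le hpr
    have hs := hq.trans_le hqs
    have h1 : Real.log (q * r / (p * s)) ≤ q * r / (p * s) - 1 :=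
      Real.log_le_sub_one_of_pos (by positivity)
    rw [Real.log_div (by positivity) (by positivity), Real.log_mul hq.ne' hr.ne',
      Real.log_mul hp.ne' hs.ne'] at h1
    have h3 := mul_le_mul_of_nonneg_left h1 hp.le
    have h4 : p * (q * r / (p * s) - 1) = q * r / s - p := by field_simp
    linarith

/-- Strong subadditivity. -/
theorem shannonEntropy_submodular (hA : Measurable A) (hB : Measurable B) (hD : Measurable D) :
    shannonEntropy μ (fun x => (A x, B x, D x)) + shannonEntropy μ D ≤
      shannonEntropy μ (fun x => (A x, D x)) + shannonEntropy μ (fun x => (B x, D x)) := by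
  classical
  let p : α → β → δ → ℝ := fun a b d => μ.real ((fun x => (A x, B x, D x)) ⁻¹' {(a, b, d)})
  have hABD : Measurable fun x => (A x, B x, D x) := by fun_prop
  have hp : ∀ a b d, 0 ≤ p a b d := fun _ _ _ => measureReal_nonneg
  have hq : ∀ a d, μ.real ((fun x => (A x, D x)) ⁻¹' {(a, d)}) = ∑ b, p a b d := by
    intro a d
    have h := measureReal_preimage_eq_sum (μ := μ) (fun y : α × β × δ => (y.1, y.2.2)) hABD (a, d)
    refine Eq.trans ?_ (h.trans ?_)
    · rfl
    · refine Finset.sum_bij_ne_zero (fun y _ _ => y.2.1) (by simp) ?_ ?_ ?_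
      · rintro ⟨a1, b1, d1⟩ h1 - ⟨a2, b2, d2⟩ h2 - h3
        simp_all
      · intro b _ hb
        exact ⟨(a, b, d), by simp, hb, rfl⟩
      · rintro ⟨a1, b1, d1⟩ h1 -
        simp at h1
        simp [p, h1]
  have hr : ∀ b d, μ.real ((fun x => (B x, D x)) ⁻¹' {(b, d)}) = ∑ a, p a b d := by
    intro b d
    have h := measureReal_preimage_eq_sum (μ := μ) (fun y : α × β × δ => (y.2.1, y.2.2)) hABD (b, d)
    refine Eq.trans ?_ (h.trans ?_)
    · rfl
    · refine Finset.sum_bij_ne_zero (fun y _ _ => y.1) (by simp) ?_ ?_ ?_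
      · rintro ⟨a1, b1, d1⟩ h1 - ⟨a2, b2, d2⟩ h2 - h3
        simp_all
      · intro a _ hb
        exact ⟨(a, b, d), by simp, hb, rfl⟩
      · rintro ⟨a1, b1, d1⟩ h1 -
        simp at h1
        simp [p, h1]
  have hs : ∀ d, μ.real (D ⁻¹' {d}) = ∑ a, ∑ b, p a b d := by
    intro d
    have h := measureReal_preimage_eq_sum (μ := μ) (fun y : α × δ => y.2) (hA.prodMk hD) d
    refine Eq.trans ?_ (h.trans ?_)
    · rfl
    · refine Finset.sum_bij_ne_zero (fun y _ _ => y.1) (by simp) ?_ ?_ ?_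
      · rintro ⟨a1, d1⟩ h1 - ⟨a2, d2⟩ h2 - h3
        simp_all
      · intro a _ hb
        exact ⟨(a, d), by simp, by rwa [hq], rfl⟩
      · rintro ⟨a1, d1⟩ h1 -
        simp at h1
        simp [← hq, h1]
  let q : α → δ → ℝ := fun a d => ∑ b, p a b d
  let r : β → δ → ℝ := fun b d => ∑ a, p a b d
  let s : δ → ℝ := fun d => ∑ a, ∑ b, p a b d
  have e1 : shannonEntropy μ (fun x => (A x, B x, D x)) =
      ∑ d, ∑ a, ∑ b, -(p a b d * Real.log (p a b d)) := by
    simp only [shannonEntropy, Fintype.sum_prod_type]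
    rw [Finset.sum_comm (s := (Finset.univ : Finset δ))]
    refine Finset.sum_congr rfl fun a _ => ?_
    rw [Finset.sum_comm]
    refine Finset.sum_congr rfl fun d _ => Finset.sum_congr rfl fun b _ => ?_
    rw [Real.negMulLog, neg_mul]
  have e2 : shannonEntropy μ (fun x => (A x, D x)) =
      ∑ d, ∑ a, ∑ b, -(p a b d * Real.log (q a d)) := by
    rw [shannonEntropy, Fintype.sum_prod_type_right]
    refine Finset.sum_congr rfl fun d _ => Finset.sum_congr rfl fun a _ => ?_
    rw [hq, Real.negMulLog, Finset.sum_neg_distrib, ← Finset.sum_mul, neg_mul]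
  have e3 : shannonEntropy μ (fun x => (B x, D x)) =
      ∑ d, ∑ a, ∑ b, -(p a b d * Real.log (r b d)) := by
    rw [shannonEntropy, Fintype.sum_prod_type_right]
    refine Finset.sum_congr rfl fun d _ => ?_
    rw [Finset.sum_comm]
    refine Finset.sum_congr rfl fun a _ => ?_
    rw [hr, Real.negMulLog, Finset.sum_neg_distrib, ← Finset.sum_mul, neg_mul]
  have e4 : shannonEntropy μ D = ∑ d, ∑ a, ∑ b, -(p a b d * Real.log (s d)) := by
    rw [shannonEntropy]
    refine Finset.sum_congr rfl fun d _ => ?_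
    rw [hs, Real.negMulLog]
    simp only [Finset.sum_neg_distrib, ← Finset.sum_mul, neg_mul]
    rfl
  have key : ∑ d, ∑ a, ∑ b, (p a b d * Real.log (q a d) + p a b d * Real.log (r b d)
      - p a b d * Real.log (p a b d) - p a b d * Real.log (s d)) ≤ 0 := by
    refine Finset.sum_nonpos fun d _ => ?_
    -- Both marginals q and r of the slice d sum to s d, so the termwise upper bounds cancel. If s d
    -- = 0, the convention x / 0 = 0 gives the same value.
    have h1 : ∑ a, ∑ b, (q a d * r b d / s d - p a b d) = 0 := by
      have : ∑ a, ∑ b, q a d * r b d / s d = s d := by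
        have hsq : ∑ a, q a d = s d := rfl
        have hsr : ∑ b, r b d = s d := Finset.sum_comm
        simp_rw [mul_div_assoc, ← Finset.mul_sum, ← Finset.sum_div, ← Finset.sum_mul]
        rw [hsq, hsr]
        by_cases h0 : s d = 0
        · simp [h0]
        · field_simp
      simp only [Finset.sum_sub_distrib, this]
      exact sub_self _
    rw [← h1]
    refine Finset.sum_le_sum fun a _ => Finset.sum_le_sum fun b _ => ?_
    refine mul_log_le_of_le (hp a b d) ?_ ?_ ?_
    · exact Finset.single_le_sum (f := fun b => p a b d) (fun b _ => hp a b d) (Finset.mem_univ b)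
    · exact Finset.single_le_sum (f := fun a => p a b d) (fun a _ => hp a b d) (Finset.mem_univ a)
    · exact Finset.single_le_sum (f := fun a => ∑ b, p a b d)
        (fun a _ => Finset.sum_nonneg fun b _ => hp a b d) (Finset.mem_univ a)
  rw [e1, e2, e3, e4, ← Finset.sum_add_distrib, ← Finset.sum_add_distrib]
  simp only [← Finset.sum_add_distrib]
  rw [← sub_nonpos]
  simp only [← Finset.sum_sub_distrib]
  refine le_trans (le_of_eq ?_) key
  refine Finset.sum_congr rfl fun d _ => Finset.sum_congr rfl fun a _ =>
    Finset.sum_congr rfl fun b _ => ?_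
  ring

end ShannonEntropy

/-! ### Conditional entropy and itineraries -/

section ConditionalEntropy

set_option linter.unusedSectionVars false

variable {X α β δ : Type*} [MeasurableSpace X]
  [Fintype α] [MeasurableSpace α] [MeasurableSingletonClass α]
  [Fintype β] [MeasurableSpace β] [MeasurableSingletonClass β]
  [Fintype δ] [MeasurableSpace δ] [MeasurableSingletonClass δ]
  {μ : Measure X} [IsProbabilityMeasure μ] {A : X → α} {B : X → β} {D : X → δ}

theorem condShannonEntropy_nonneg (hA : Measurable A) (hB : Measurable B) :
    0 ≤ condShannonEntropy μ A B :=
  sub_nonneg.2 <| shannonEntropy_le_of_factor (hA.prodMk hB) fun _ _ h => (Prod.ext_iff.1 h).2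

theorem condShannonEntropy_mono_left (hA : Measurable A) (hD : Measurable D)
    (h : ∀ x y, A x = A y → D x = D y → B x = B y) :
    condShannonEntropy μ B D ≤ condShannonEntropy μ A D := by
  refine sub_le_sub_right (shannonEntropy_le_of_factor (hA.prodMk hD) fun x y hxy => ?_) _
  obtain ⟨h1, h2⟩ := Prod.ext_iff.1 hxy
  exact Prod.ext (h x y h1 h2) h2

/-- As D is a function of B, the pair (B, D) defines the same partition as B, and the claim becomes
strong subadditivity. -/
theorem condShannonEntropy_mono_right (hA : Measurable A) (hB : Measurable B) (hD : Measurable D)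
    (h : ∀ x y, B x = B y → D x = D y) :
    condShannonEntropy μ A B ≤ condShannonEntropy μ A D := by
  have h1 := shannonEntropy_submodular (μ := μ) hA hB hD
  have h2 : shannonEntropy μ (fun x => (A x, B x, D x)) = shannonEntropy μ fun x => (A x, B x) :=
    shannonEntropy_eq_of_factor (by fun_prop) (by fun_prop) fun x y => by
      simp only [Prod.ext_iff]
      exact ⟨fun h => ⟨h.1, h.2.1⟩, fun h' => ⟨h'.1, h'.2, h x y h'.2⟩⟩
  have h3 : shannonEntropy μ (fun x => (B x, D x)) = shannonEntropy μ B :=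
    shannonEntropy_eq_of_factor (by fun_prop) (by fun_prop) fun x y => by
      simp only [Prod.ext_iff]
      exact ⟨fun h => h.1, fun h' => ⟨h', h x y h'⟩⟩
  rw [condShannonEntropy, condShannonEntropy]
  linarith

theorem condShannonEntropy_prodMk_le (hA : Measurable A) (hB : Measurable B) (hD : Measurable D) :
    condShannonEntropy μ (fun x => (A x, B x)) D ≤
      condShannonEntropy μ A D + condShannonEntropy μ B D := by
  have h1 := shannonEntropy_submodular (μ := μ) hA hB hD
  have h2 : shannonEntropy μ (fun x => (A x, B x, D x)) =
      shannonEntropy μ fun x => ((A x, B x), D x) :=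
    shannonEntropy_eq_of_factor (by fun_prop) (by fun_prop) fun x y => by
      simp only [Prod.ext_iff, and_assoc]
  simp only [condShannonEntropy]
  linarith

/-- Chain rule: H(A | D) ≤ H(A, B | D) = H(A | B, D) + H(B | D), and dropping D from the first
condition only increases it. -/
theorem condShannonEntropy_trans (hA : Measurable A) (hB : Measurable B) (hD : Measurable D) :
    condShannonEntropy μ A D ≤ condShannonEntropy μ A B + condShannonEntropy μ B D := by
  have h1 : condShannonEntropy μ A D ≤ condShannonEntropy μ (fun x => (A x, B x)) D :=
    condShannonEntropy_mono_left (by fun_prop) hD fun x y h _ => (Prod.ext_iff.1 h).1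
  have h2 : shannonEntropy μ (fun x => (A x, B x, D x)) =
      shannonEntropy μ fun x => ((A x, B x), D x) :=
    shannonEntropy_eq_of_factor (by fun_prop) (by fun_prop) fun x y => by
      simp only [Prod.ext_iff, and_assoc]
  have h3 : condShannonEntropy μ A (fun x => (B x, D x)) ≤ condShannonEntropy μ A B :=
    condShannonEntropy_mono_right hA (by fun_prop) hB fun x y h => (Prod.ext_iff.1 h).1
  simp only [condShannonEntropy] at *
  linarith

theorem shannonEntropy_prodMk_le (hA : Measurable A) (hB : Measurable B) :
    shannonEntropy μ (fun x => (A x, B x)) ≤ shannonEntropy μ A + shannonEntropy μ B := by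
  have hu : Measurable fun _ : X => () := measurable_const
  have h1 := shannonEntropy_submodular (μ := μ) hA hB hu
  have h2 : shannonEntropy μ (fun x => (A x, B x, ())) = shannonEntropy μ fun x => (A x, B x) :=
    shannonEntropy_eq_of_factor (by fun_prop) (by fun_prop) fun x y => by simp
  have h3 : shannonEntropy μ (fun x => (A x, ())) = shannonEntropy μ A :=
    shannonEntropy_eq_of_factor (by fun_prop) (by fun_prop) fun x y => by simp
  have h4 : shannonEntropy μ (fun x => (B x, ())) = shannonEntropy μ B :=
    shannonEntropy_eq_of_factor (by fun_prop) (by fun_prop) fun x y => by simp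
  have h5 : shannonEntropy μ (fun _ : X => ()) = 0 := by
    simp [shannonEntropy]
  linarith

theorem condShannonEntropy_le_log_card (hA : Measurable A) (hB : Measurable B) :
    condShannonEntropy μ A B ≤ Real.log (Fintype.card α) := by
  have h1 := shannonEntropy_prodMk_le (μ := μ) hA hB
  have h2 := shannonEntropy_le_log_card (μ := μ) hA
  rw [condShannonEntropy]
  linarith

theorem condShannonEntropy_eq_zero_of_factor (hA : Measurable A) (hB : Measurable B)
    (h : ∀ x y, B x = B y → A x = A y) : condShannonEntropy μ A B = 0 :=
  sub_eq_zero.2 <| shannonEntropy_eq_of_factor (by fun_prop) (by fun_prop) fun x y => by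
    simp only [Prod.ext_iff]
    exact ⟨fun h => h.2, fun h' => ⟨h x y h', h'⟩⟩

theorem condShannonEntropy_pi_le {n : ℕ} {A : Fin n → X → α} (hA : ∀ i, Measurable (A i))
    (hD : Measurable D) :
    condShannonEntropy μ (fun x i => A i x) D ≤ ∑ i, condShannonEntropy μ (A i) D := by
  induction n with
  | zero =>
    rw [condShannonEntropy_eq_zero_of_factor (by fun_prop) hD fun x y _ => Subsingleton.elim _ _]
    simp
  | succ n ih =>
    rw [Fin.sum_univ_succ]
    refine le_trans (condShannonEntropy_mono_left
      (A := fun x => (A 0 x, fun i : Fin n => A i.succ x)) (by fun_prop) hD ?_) <|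
      (condShannonEntropy_prodMk_le (hA 0) (by fun_prop) hD).trans <|
        add_le_add_right (ih fun i => hA i.succ) _
    intro x y h _
    obtain ⟨h1, h2⟩ := Prod.ext_iff.1 h
    funext i
    exact Fin.cases h1 (fun i => congrFun h2 i) i

theorem shannonEntropy_comp_measurePreserving {T : X → X} (hT : MeasurePreserving T μ μ)
    (hA : Measurable A) : shannonEntropy μ (A ∘ T) = shannonEntropy μ A := by
  refine Finset.sum_congr rfl fun a _ => ?_
  rw [preimage_comp, measureReal_def, measureReal_def,
    hT.measure_preimage (hA (measurableSet_singleton a)).nullMeasurableSet]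

theorem condShannonEntropy_comp_measurePreserving {T : X → X} (hT : MeasurePreserving T μ μ)
    (hA : Measurable A) (hB : Measurable B) :
    condShannonEntropy μ (A ∘ T) (B ∘ T) = condShannonEntropy μ A B := by
  rw [condShannonEntropy, condShannonEntropy, shannonEntropy_comp_measurePreserving hT hB,
    ← shannonEntropy_comp_measurePreserving hT (hA.prodMk hB)]
  rfl

/-- The first `n` labels of the `P`-itinerary under `T`. -/
def itinerary {X α : Type*} (T : X → X) (P : X → α) (n : ℕ) (x : X) : Fin n → α :=
  fun j => P (T^[j] x)

theorem measurable_itinerary {T : X → X} (hT : Measurable T) (hA : Measurable A) (n : ℕ) :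
    Measurable (itinerary T A n) :=
  measurable_pi_iff.2 fun j => hA.comp (hT.iterate j)

theorem itinerary_eq_iff {T : X → X} {n : ℕ} {x y : X} :
    itinerary T A n x = itinerary T A n y ↔ ∀ j < n, A (T^[j] x) = A (T^[j] y) :=
  ⟨fun h j hj => congrFun h ⟨j, hj⟩, fun h => funext fun j => h j j.2⟩

/-- The label at time j costs at most its entropy given the B-label at the same time, which by
invariance is H(A | B). -/
theorem condShannonEntropy_itinerary_le {T : X → X} (hT : MeasurePreserving T μ μ)
    (hA : Measurable A) (hB : Measurable B) (n : ℕ) :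
    condShannonEntropy μ (itinerary T A n) (itinerary T B n) ≤ n * condShannonEntropy μ A B := by
  have hB' := measurable_itinerary hT.measurable hB n
  have hTi := fun j : ℕ => hT.measurable.iterate j
  refine (condShannonEntropy_pi_le (A := fun (j : Fin n) x => A (T^[j] x))
    (fun j => hA.comp (hTi j)) hB').trans ?_
  have : ∀ j : Fin n, condShannonEntropy μ (fun x => A (T^[j] x)) (itinerary T B n) ≤
      condShannonEntropy μ A B := by
    intro j
    refine (condShannonEntropy_mono_right (hA.comp (hTi j)) hB' (hB.comp (hTi j)) ?_).trans_eq
      (condShannonEntropy_comp_measurePreserving (hT.iterate j) hA hB)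
    exact fun x y h => itinerary_eq_iff.1 h j j.2
  simpa using Finset.sum_le_sum fun j (_ : j ∈ Finset.univ) => this j

theorem shannonEntropy_itinerary_add_le {T : X → X} (hT : MeasurePreserving T μ μ)
    (hA : Measurable A) (m n : ℕ) :
    shannonEntropy μ (itinerary T A (m + n)) ≤
      shannonEntropy μ (itinerary T A m) + shannonEntropy μ (itinerary T A n) := by
  have hm := measurable_itinerary hT.measurable hA m
  have hn := measurable_itinerary hT.measurable hA n
  rw [← shannonEntropy_comp_measurePreserving (hT.iterate m) hn]
  refine le_trans (shannonEntropy_le_of_factor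
    (A := fun x => (itinerary T A m x, (itinerary T A n ∘ T^[m]) x)) ?_ ?_)
    (shannonEntropy_prodMk_le hm (hn.comp (hT.measurable.iterate m)))
  · exact hm.prodMk (hn.comp (hT.measurable.iterate m))
  · intro x y h
    obtain ⟨h1, h2⟩ := Prod.ext_iff.1 h
    simp only [Function.comp, itinerary_eq_iff] at h1 h2 ⊢
    intro j hj
    rcases lt_or_ge j m with hjm | hjm
    · exact h1 j hjm
    · have := h2 (j - m) (by omega)
      rwa [← Function.iterate_add_apply, ← Function.iterate_add_apply, Nat.sub_add_cancel hjm]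
        at this

/-- The indicators of the atoms converge pointwise, hence so do the measures of the atoms, and
`Real.negMulLog` is continuous. -/
theorem tendsto_shannonEntropy {P : ℕ → X → α} (hP : ∀ m, Measurable (P m))
    (h : ∀ x, ∀ᶠ m in atTop, P m x = A x) :
    Tendsto (fun m => shannonEntropy μ (P m)) atTop (nhds (shannonEntropy μ A)) := by
  refine tendsto_finsetSum _ fun a _ => Real.continuous_negMulLog.continuousAt.tendsto.comp ?_
  refine (ENNReal.tendsto_toReal (measure_ne_top μ _)).comp ?_
  refine tendsto_measure_of_tendsto_indicator_of_isFiniteMeasure atTop μ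
    (fun m => hP m (measurableSet_singleton a)) ?_
  intro x
  filter_upwards [h x] with m hm
  simp [hm]

theorem tendsto_condShannonEntropy_self {P : ℕ → X → α} (hP : ∀ m, Measurable (P m))
    (hA : Measurable A) (h : ∀ x, ∀ᶠ m in atTop, P m x = A x) :
    Tendsto (fun m => condShannonEntropy μ A (P m)) atTop (nhds 0) := by
  have h1 : shannonEntropy μ (fun x => (A x, A x)) - shannonEntropy μ A = 0 :=
    condShannonEntropy_eq_zero_of_factor hA hA fun _ _ => id
  rw [← h1]
  refine (tendsto_shannonEntropy (fun m => hA.prodMk (hP m)) fun x => ?_).sub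
    (tendsto_shannonEntropy hP h)
  filter_upwards [h x] with m hm
  rw [hm]

end ConditionalEntropy

/-! ### Partitions of zero entropy relative to a given one -/

section RelativePinsker

set_option linter.unusedSectionVars false

variable {X α β σ : Type*} [MeasurableSpace X]
  [Fintype α] [MeasurableSpace α] [MeasurableSingletonClass α]
  [Fintype β] [MeasurableSpace β] [MeasurableSingletonClass β]
  [Fintype σ] [MeasurableSpace σ] [MeasurableSingletonClass σ]
  {μ : Measure X} [IsProbabilityMeasure μ] {T : X → X} {A : X → α} {B : X → β} {S : X → σ}

/-- The partition `A` has zero entropy relative to the partition `S`. -/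
def HasZeroRelEntropy {α σ : Type*} [Fintype α] [Fintype σ] (μ : Measure X) (T : X → X)
    (S : X → σ) (A : X → α) : Prop :=
  Tendsto (fun n : ℕ => condShannonEntropy μ (itinerary T A n) (itinerary T S n) / n) atTop
    (nhds 0)

theorem HasZeroRelEntropy.of_le (hT : Measurable T) (hA : Measurable A) (hS : Measurable S)
    {e : ℕ → ℝ} (he : Tendsto (fun n => e n / n) atTop (nhds 0))
    (h : ∀ n, condShannonEntropy μ (itinerary T A n) (itinerary T S n) ≤ e n) :
    HasZeroRelEntropy μ T S A :=
  squeeze_zero (fun n => div_nonneg (condShannonEntropy_nonneg (measurable_itinerary hT hA n)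
    (measurable_itinerary hT hS n)) n.cast_nonneg)
    (fun n => div_le_div_of_nonneg_right (h n) n.cast_nonneg) he

theorem HasZeroRelEntropy.of_factor (hA0 : HasZeroRelEntropy μ T S A) (hT : Measurable T)
    (hA : Measurable A) (hB : Measurable B) (hS : Measurable S)
    (h : ∀ x y, A x = A y → B x = B y) : HasZeroRelEntropy μ T S B := by
  refine .of_le hT hB hS hA0 fun n => condShannonEntropy_mono_left (measurable_itinerary hT hA n)
    (measurable_itinerary hT hS n) fun x y hxy _ => ?_
  rw [itinerary_eq_iff] at hxy ⊢
  exact fun j hj => h _ _ (hxy j hj)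

theorem HasZeroRelEntropy.prodMk (hA0 : HasZeroRelEntropy μ T S A)
    (hB0 : HasZeroRelEntropy μ T S B) (hT : Measurable T)
    (hA : Measurable A) (hB : Measurable B) (hS : Measurable S) :
    HasZeroRelEntropy μ T S fun x => (A x, B x) := by
  have h0 := Tendsto.add hA0 hB0
  simp only [← add_div, add_zero] at h0
  refine .of_le hT (hA.prodMk hB) hS h0 fun n => ?_
  have hA' := measurable_itinerary hT hA n
  have hB' := measurable_itinerary hT hB n
  have hS' := measurable_itinerary hT hS n
  refine le_trans (condShannonEntropy_mono_left (hA'.prodMk hB') hS' fun x y h _ => ?_)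
    (condShannonEntropy_prodMk_le hA' hB' hS')
  obtain ⟨h1, h2⟩ := Prod.ext_iff.1 h
  rw [itinerary_eq_iff] at h1 h2 ⊢
  exact fun j hj => Prod.ext (h1 j hj) (h2 j hj)

theorem HasZeroRelEntropy.pi {n : ℕ} {A : Fin n → X → α}
    (hA0 : ∀ i, HasZeroRelEntropy μ T S (A i)) (hT : Measurable T)
    (hA : ∀ i, Measurable (A i)) (hS : Measurable S) :
    HasZeroRelEntropy μ T S fun x i => A i x := by
  have h0 := tendsto_finsetSum Finset.univ fun i _ => hA0 i
  simp only [← Finset.sum_div, Finset.sum_const_zero] at h0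
  refine .of_le hT (measurable_pi_iff.2 hA) hS h0 fun m => ?_
  have hA' := fun i => measurable_itinerary hT (hA i) m
  have hS' := measurable_itinerary hT hS m
  refine le_trans (condShannonEntropy_mono_left (A := fun x i => itinerary T (A i) m x)
    (measurable_pi_iff.2 hA') hS' fun x y h _ => ?_) (condShannonEntropy_pi_le hA' hS')
  rw [itinerary_eq_iff]
  exact fun j hj => funext fun i => itinerary_eq_iff.1 (congrFun h i) j hj

/-- Partitions of zero relative entropy are closed under pointwise limits. -/
theorem HasZeroRelEntropy.of_tendsto {P : ℕ → X → α} (hP0 : ∀ m, HasZeroRelEntropy μ T S (P m))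
    (hT : MeasurePreserving T μ μ) (hP : ∀ m, Measurable (P m)) (hA : Measurable A)
    (hS : Measurable S) (h : ∀ x, ∀ᶠ m in atTop, P m x = A x) : HasZeroRelEntropy μ T S A := by
  have hlim := tendsto_condShannonEntropy_self (μ := μ) hP hA h
  refine Metric.tendsto_atTop.2 fun ε hε => ?_
  obtain ⟨m, hm⟩ := (hlim.eventually_lt_const (half_pos hε)).exists
  obtain ⟨N, hN⟩ := eventually_atTop.1 ((hP0 m).eventually_lt_const (half_pos hε))
  refine ⟨max N 1, fun n hn => ?_⟩
  have hn0 : (0 : ℝ) < n := by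
    have : 1 ≤ n := le_trans (le_max_right _ _) hn
    exact_mod_cast this
  have hA' := measurable_itinerary hT.measurable hA n
  have hP' := measurable_itinerary hT.measurable (hP m) n
  have hS' := measurable_itinerary hT.measurable hS n
  -- Replacing A by the approximation P m costs at most n · H(A | P m) < n ε / 2 with m independent
  -- of n; the itinerary of P m costs another n ε / 2 for large n.
  have h1 := condShannonEntropy_trans (μ := μ) hA' hP' hS'
  have h2 := condShannonEntropy_itinerary_le hT hA (hP m) n
  have h3 := hN n (le_trans (le_max_left _ _) hn)
  rw [Real.dist_0_eq_abs, abs_of_nonneg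
    (div_nonneg (condShannonEntropy_nonneg hA' hS') n.cast_nonneg), div_lt_iff₀ hn0]
  rw [div_lt_iff₀ hn0] at h3
  nlinarith

/-- The σ-algebra of sets of zero entropy relative to the partition `S`. -/
abbrev relPinsker (hT : MeasurePreserving T μ μ) (hS : Measurable S) : MeasurableSpace X where
  MeasurableSet' E := MeasurableSet E ∧ HasZeroRelEntropy μ T S (· ∈ E)
  measurableSet_empty := by
    refine ⟨MeasurableSet.empty, ?_⟩
    refine .of_le (e := fun _ => 0) hT.measurable (by simp) hS (by simp) fun n => ?_
    refine (condShannonEntropy_eq_zero_of_factor ?_ (measurable_itinerary hT.measurable hS n)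
      fun x y _ => ?_).le
    · exact measurable_itinerary hT.measurable (by simp) n
    · simp [itinerary_eq_iff]
  measurableSet_compl E hE := by
    refine ⟨hE.1.compl, hE.2.of_factor hT.measurable hE.1.mem hE.1.compl.mem hS fun x y h => ?_⟩
    simp only [mem_compl_iff, h]
  measurableSet_iUnion E hE := by
    -- A finite union is a function of finitely many indicators. At each point the finite unions
    -- eventually agree with the countable one, so closure under limits applies.
    have hU : ∀ m, HasZeroRelEntropy μ T S (· ∈ ⋃ i : Fin m, E i) := by
      intro m
      refine (HasZeroRelEntropy.pi (A := fun i : Fin m => (· ∈ E i)) (fun i => (hE i).2)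
        hT.measurable (fun i => (hE i).1.mem) hS).of_factor hT.measurable
        (measurable_pi_iff.2 fun i => (hE i).1.mem)
        (MeasurableSet.iUnion fun i : Fin m => (hE i).1).mem hS fun x y h => ?_
      have := fun i => congrFun h i
      simp only [mem_iUnion] at this ⊢
      simp only [this]
    refine ⟨MeasurableSet.iUnion fun i => (hE i).1, HasZeroRelEntropy.of_tendsto hU hT
      (fun m => (MeasurableSet.iUnion fun i : Fin m => (hE i).1).mem)
      (MeasurableSet.iUnion fun i => (hE i).1).mem hS fun x => ?_⟩
    by_cases hx : x ∈ ⋃ i, E i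
    · obtain ⟨i, hi⟩ := mem_iUnion.1 hx
      filter_upwards [eventually_gt_atTop i] with m hm
      simp only [hx, mem_iUnion, eq_iff_iff, iff_true]
      exact ⟨⟨i, hm⟩, hi⟩
    · refine Eventually.of_forall fun m => ?_
      simp only [hx, eq_iff_iff, iff_false]
      intro h
      obtain ⟨i, hi⟩ := mem_iUnion.1 h
      exact hx (mem_iUnion.2 ⟨i, hi⟩)

theorem hasZeroRelEntropy_of_le_relPinsker (hT : MeasurePreserving T μ μ) (hS : Measurable S)
    (h : ‹MeasurableSpace X› ≤ relPinsker hT hS) {k : ℕ} {P : X → Fin k} (hP : Measurable P) :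
    HasZeroRelEntropy μ T S P := by
  have hE : ∀ a, MeasurableSet (P ⁻¹' {a}) := fun a => hP (measurableSet_singleton a)
  refine (HasZeroRelEntropy.pi (A := fun a => (· ∈ P ⁻¹' {a})) (fun a => (h _ (hE a)).2)
    hT.measurable (fun a => (hE a).mem) hS).of_factor hT.measurable
    (measurable_pi_iff.2 fun a => (hE a).mem) hP hS fun x y hxy => ?_
  exact (Eq.mp (congrFun hxy (P x)) (mem_singleton (P x)) : P y = P x).symm

/-- Fekete's lemma. Because the limit is an infimum, a single word length m already bounds the
entropy rate. -/
theorem tendsto_shannonEntropy_itinerary (hT : MeasurePreserving T μ μ) (hS : Measurable S) :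
    ∃ h : ℝ, Tendsto (fun n : ℕ => shannonEntropy μ (itinerary T S n) / n) atTop (nhds h) ∧
      ∀ m : ℕ, m ≠ 0 → h ≤ shannonEntropy μ (itinerary T S m) / m := by
  have hsub : Subadditive fun n => shannonEntropy μ (itinerary T S n) :=
    fun m n => shannonEntropy_itinerary_add_le hT hS m n
  have hbdd : BddBelow (range fun n : ℕ => shannonEntropy μ (itinerary T S n) / n) := by
    refine ⟨0, ?_⟩
    rintro _ ⟨n, rfl⟩
    refine div_nonneg (Finset.sum_nonneg fun a _ => ?_) n.cast_nonneg
    exact Real.negMulLog_nonneg measureReal_nonneg measureReal_le_one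
  exact ⟨hsub.lim, hsub.tendsto_lim hbdd, fun m hm => hsub.lim_le_div hbdd hm⟩

/-- If every measurable set has zero entropy relative to the partition `S`, then the entropy of
`T` is bounded by the normalized entropies of the iterated partitions of `S`. -/
theorem measureEntropy_le (hT : MeasurePreserving T μ μ) (hS : Measurable S)
    (h : ‹MeasurableSpace X› ≤ relPinsker hT hS) {m : ℕ} (hm : m ≠ 0) :
    measureEntropy μ T ≤ ((shannonEntropy μ (itinerary T S m) / m : ℝ) : EReal) := by
  obtain ⟨e, he, hle⟩ := tendsto_shannonEntropy_itinerary hT hS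
  refine le_trans ?_ (EReal.coe_le_coe_iff.2 (hle m hm))
  refine iSup_le fun k => iSup_le fun P => iSup_le fun hP => ?_
  -- H(Pⁿ) ≤ H(Sⁿ) + H(Pⁿ | Sⁿ), where the last term is o(n); the sum divided by n converges to e,
  -- which bounds the limsup.
  have h0 := he.add (hasZeroRelEntropy_of_le_relPinsker hT hS h hP)
  rw [add_zero] at h0
  rw [← (continuous_coe_real_ereal.tendsto e |>.comp h0).limsup_eq]
  refine limsup_le_limsup (Eventually.of_forall fun n => ?_)
  refine EReal.coe_le_coe_iff.2 ?_
  beta_reduce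
  rw [← add_div]
  refine div_le_div_of_nonneg_right ?_ n.cast_nonneg
  have hP' := measurable_itinerary hT.measurable hP n
  have hS' := measurable_itinerary hT.measurable hS n
  have h1 : itineraryEntropy μ T P n = shannonEntropy μ (itinerary T P n) := by
    refine Finset.sum_congr rfl fun w _ => ?_
    congr 2
    ext x
    simp [itinerary, funext_iff]
  rw [h1, condShannonEntropy]
  have : shannonEntropy μ (itinerary T P n) ≤
      shannonEntropy μ (fun x => (itinerary T P n x, itinerary T S n x)) :=
    shannonEntropy_le_of_factor (hP'.prodMk hS') fun x y h => (Prod.ext_iff.1 h).1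
  linarith

end RelativePinsker

/-! ### Symbolic coding of the skew product -/

/-- The shift of bi-infinite sequences. -/
def bishift (ξ : ℤ → Fin 3) : ℤ → Fin 3 := fun n => ξ (n + 1)

namespace AffineHorseshoe

variable (S : AffineHorseshoe)

/-- The horseshoe. -/
abbrev Γ : Set (ℝ × ℝ) := horseshoeSet S.Φ fun i => Icc (S.lo i) (S.hi i)

theorem eq_of_mem_leg {i j : Fin 3} {x : ℝ × ℝ} (hi : x ∈ S.leg i) (hj : x ∈ S.leg j) : i = j := by
  by_contra h
  exact disjoint_left.1 (S.leg_disjoint i j h) hi hj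

theorem symbol_eq {i : Fin 3} {x : ℝ × ℝ} (hi : x ∈ S.leg i) : S.symbol x = i := by
  unfold symbol
  split_ifs with h0 h1
  · exact S.eq_of_mem_leg h0 hi
  · exact S.eq_of_mem_leg h1 hi
  · fin_cases i
    · exact absurd hi h0
    · exact absurd hi h1
    · rfl

theorem ϖ_apply_eq {x : S.Γ} {n : ℤ} {i : Fin 3} (h : (S.Φ ^ n) (x : ℝ × ℝ) ∈ S.leg i) :
    S.ϖ x n = i :=
  S.eq_of_mem_leg (S.coding x n) h

theorem zpow_Φ_apply (n : ℤ) (x : ℝ × ℝ) : (S.Φ ^ n) (S.Φ x) = (S.Φ ^ (n + 1)) x := by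
  rw [zpow_add, zpow_one, Equiv.Perm.mul_apply]

theorem Φ_mem_Γ {x : ℝ × ℝ} (hx : x ∈ S.Γ) : S.Φ x ∈ S.Γ := fun n => by
  rw [zpow_Φ_apply]
  exact hx (n + 1)

theorem ϖ_Φ (x : S.Γ) : S.ϖ ⟨S.Φ x, S.Φ_mem_Γ x.2⟩ = bishift (S.ϖ x) := by
  funext n
  refine S.ϖ_apply_eq ?_
  have := S.coding x (n + 1)
  rwa [← zpow_Φ_apply] at this

theorem ϖ_symm_bishift (ξ : ℤ → Fin 3) :
    (S.ϖ.symm (bishift ξ) : ℝ × ℝ) = S.Φ (S.ϖ.symm ξ) := by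
  have := S.ϖ_Φ (S.ϖ.symm ξ)
  rw [S.ϖ.apply_symm_apply] at this
  rw [← this, S.ϖ.symm_apply_apply]

theorem ϖ_symm_mem_leg (ξ : ℤ → Fin 3) : (S.ϖ.symm ξ : ℝ × ℝ) ∈ S.leg (ξ 0) := by
  simpa [leg] using S.coding (S.ϖ.symm ξ) 0

end AffineHorseshoe

namespace HorseshoeSkewProduct

variable (S : HorseshoeSkewProduct)

variable {S} in
theorem mem_domain {i : Fin 3} {R : (ℝ × ℝ) × ℝ} (h1 : R.1 ∈ S.leg i) (h2 : R.2 ∈ Icc (0 : ℝ) 1) :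
    R ∈ S.domain :=
  mem_iUnion.2 ⟨i, h1, h2⟩

theorem orbit_fst {z : ℤ → (ℝ × ℝ) × ℝ} (hz : ∀ n, z n ∈ S.domain ∧ S.F (z n) = z (n + 1))
    (n : ℤ) : (z n).1 = (S.Φ ^ n) (z 0).1 := by
  have hstep : ∀ n, (z (n + 1)).1 = S.Φ (z n).1 := fun n => by rw [← (hz n).2]; rfl
  induction n using Int.induction_on with
  | zero => simp
  | succ n ih => rw [hstep, ih, add_comm, zpow_add, zpow_one, Equiv.Perm.mul_apply]
  | pred n ih =>
    apply S.Φ.injective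
    rw [← hstep, sub_add_cancel, ih, ← Equiv.Perm.mul_apply, ← zpow_one_add]
    congr 2
    ring

theorem fst_mem_Γ (R : S.Λ) : (R : (ℝ × ℝ) × ℝ).1 ∈ S.Γ := by
  obtain ⟨z, hz0, hz⟩ := R.2
  intro n
  have := (hz n).1
  rw [← hz0, ← S.orbit_fst hz n]
  obtain ⟨i, hi, -⟩ := mem_iUnion.1 this
  exact mem_iUnion.2 ⟨i, hi⟩

/-- The symbolic itinerary of a point of `Λ`. -/
noncomputable def code (R : S.Λ) : ℤ → Fin 3 := S.ϖ ⟨(R : (ℝ × ℝ) × ℝ).1, S.fst_mem_Γ R⟩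

/-- The fiber coordinate. -/
noncomputable def height (R : S.Λ) : ℝ := (R : (ℝ × ℝ) × ℝ).2

theorem ϖ_symm_code (R : S.Λ) : (S.ϖ.symm (S.code R) : ℝ × ℝ) = (R : (ℝ × ℝ) × ℝ).1 := by
  rw [code, S.ϖ.symm_apply_apply]

theorem fst_mem_leg (R : S.Λ) : (R : (ℝ × ℝ) × ℝ).1 ∈ S.leg (S.code R 0) := by
  rw [← ϖ_symm_code]
  exact S.ϖ_symm_mem_leg _

theorem symbol_fst (R : S.Λ) : S.symbol (R : (ℝ × ℝ) × ℝ).1 = S.code R 0 :=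
  S.symbol_eq (S.fst_mem_leg R)

theorem height_mem (R : S.Λ) : S.height R ∈ Icc (0 : ℝ) 1 := by
  obtain ⟨z, hz0, hz⟩ := R.2
  have := (hz 0).1
  rw [hz0] at this
  obtain ⟨i, -, hi⟩ := mem_iUnion.1 this
  exact hi

theorem code_FΛ (R : S.Λ) : S.code (S.FΛ R) = bishift (S.code R) :=
  S.ϖ_Φ ⟨_, S.fst_mem_Γ R⟩

theorem height_FΛ (R : S.Λ) : S.height (S.FΛ R) = S.f (S.code R 0) (S.height R) := by
  rw [← symbol_fst]
  rfl

theorem code_iterate (R : S.Λ) (j : ℕ) (i : ℤ) : S.code (S.FΛ^[j] R) i = S.code R (i + j) := by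
  induction j generalizing R with
  | zero => simp
  | succ j ih =>
    rw [Function.iterate_succ_apply, ih, code_FΛ, bishift]
    push_cast
    ring_nf

theorem measurable_code : Measurable S.code := by
  have : Continuous S.code := S.ϖ.continuous.comp (by fun_prop)
  exact this.measurable

theorem measurable_height : Measurable S.height := by
  unfold height
  fun_prop

theorem measurable_FΛ : Measurable S.FΛ := by
  refine Measurable.subtype_mk ?_
  have h2 : Measurable fun R : S.Λ => S.f (S.code R 0) (S.height R) := by
    -- The fiber maps are controlled only on [0,1]; precomposing with the projection onto [0,1]
    -- gives a continuous map of the line that agrees with them on Λ.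
    have h : Measurable fun p : Fin 3 × ℝ => S.f p.1 (projIcc 0 1 zero_le_one p.2) := by
      refine measurable_from_prod_countable_right fun i => ?_
      have : Continuous fun x : ℝ => S.f i (projIcc 0 1 zero_le_one x) :=
        (S.contDiffOn i).continuousOn.domRestrict.comp continuous_projIcc
      exact this.measurable
    have h' := h.comp ((measurable_pi_iff.1 S.measurable_code 0).prodMk S.measurable_height)
    convert h' using 2 with R
    simp [projIcc_of_mem _ (S.height_mem R)]
  have h1 : Measurable fun R : S.Λ => S.Φ (R : (ℝ × ℝ) × ℝ).1 :=
    S.contDiff_Φ.continuous.measurable.comp (by fun_prop)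
  have h3 : (fun R : S.Λ => S.F R) =
      fun R : S.Λ => (S.Φ (R : (ℝ × ℝ) × ℝ).1, S.f (S.code R 0) (S.height R)) := by
    funext R
    rw [← symbol_fst]
    rfl
  exact h3 ▸ h1.prodMk h2

/-- The σ-algebra of `Λ` is generated by the symbolic itinerary and the fiber coordinate. -/
theorem borel_le {m : MeasurableSpace S.Λ} (h1 : Measurable[m] S.code)
    (h2 : Measurable[m] S.height) : (Subtype.instMeasurableSpace : MeasurableSpace S.Λ) ≤ m := by
  refine Measurable.comap_le (f := (Subtype.val : S.Λ → (ℝ × ℝ) × ℝ)) ?_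
  have h3 : Measurable fun ξ => (S.ϖ.symm ξ : ℝ × ℝ) :=
    (continuous_subtype_val.comp S.ϖ.symm.continuous).measurable
  have h4 : (Subtype.val : S.Λ → (ℝ × ℝ) × ℝ) =
      fun R => ((S.ϖ.symm (S.code R) : ℝ × ℝ), S.height R) := by
    funext R
    rw [ϖ_symm_code]
    rfl
  rw [h4]
  exact (h3.comp h1).prodMk h2

end HorseshoeSkewProduct

/-! ### The fiber entropy vanishes -/

theorem Measurable.of_factor {X α β : Type*} [MeasurableSpace X]
    [Finite α] [MeasurableSpace α] [MeasurableSingletonClass α] [MeasurableSpace β]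
    {A : X → α} {B : X → β} (hA : Measurable A) (h : ∀ x y, A x = A y → B x = B y) :
    Measurable B := by
  rcases isEmpty_or_nonempty X with hX | ⟨⟨x₀⟩⟩
  · exact measurable_of_empty B
  · have : Nonempty β := ⟨B x₀⟩
    have hBA : Function.FactorsThrough B A := fun x y hxy => h x y hxy
    obtain ⟨φ, hφ⟩ := (Function.factorsThrough_iff B).1 hBA
    rw [hφ]
    exact (Measurable.of_discrete (f := φ)).comp hA

theorem tendsto_log_succ_div : Tendsto (fun n : ℕ => Real.log (n + 1) / n) atTop (nhds 0) := by
  have h := (Real.tendsto_pow_log_div_mul_add_atTop 1 (-1) 1 one_ne_zero).comp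
    (tendsto_atTop_add_const_right atTop (1 : ℝ) tendsto_natCast_atTop_atTop)
  refine h.congr fun n => ?_
  simp

namespace HorseshoeSkewProduct

variable (S : HorseshoeSkewProduct)

/-- A continuous injection of an interval is strictly monotone, and ε records the direction. -/
theorem exists_orientation : ∃ ε : Fin 3 → ℝ, (∀ i, ε i = 1 ∨ ε i = -1) ∧
    ∀ i, ∀ x ∈ Icc (0 : ℝ) 1, ∀ y ∈ Icc (0 : ℝ) 1, x ≤ y → 0 ≤ ε i * (S.f i y - S.f i x) := by
  have : ∀ i, ∃ e : ℝ, (e = 1 ∨ e = -1) ∧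
      ∀ x ∈ Icc (0 : ℝ) 1, ∀ y ∈ Icc (0 : ℝ) 1, x ≤ y → 0 ≤ e * (S.f i y - S.f i x) := by
    intro i
    rcases (S.contDiffOn i).continuousOn.strictMonoOn_of_injOn_Icc' zero_le_one (S.injOn i)
      with h | h
    · refine ⟨1, Or.inl rfl, fun x hx y hy hxy => ?_⟩
      have := h.monotoneOn hx hy hxy
      linarith
    · refine ⟨-1, Or.inr rfl, fun x hx y hy hxy => ?_⟩
      have := h.antitoneOn hx hy hxy
      linarith
  choose ε h1 h2 using this
  exact ⟨ε, h1, h2⟩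

/-- The orientation of the `j`-th iterate of `F` along the fiber of `R`. -/
noncomputable def orbitSign (ε : Fin 3 → ℝ) (R : S.Λ) (j : ℕ) : ℝ := ∏ k ∈ Finset.range j, ε (S.code R k)

variable {S} {ε : Fin 3 → ℝ}

theorem orbitSign_eq (hε : ∀ i, ε i = 1 ∨ ε i = -1) (R : S.Λ) (j : ℕ) :
    S.orbitSign ε R j = 1 ∨ S.orbitSign ε R j = -1 := by
  induction j with
  | zero => simp [orbitSign]
  | succ j ih =>
    rw [orbitSign, Finset.prod_range_succ]
    rw [orbitSign] at ih
    rcases ih with h | h <;> rcases hε (S.code R j) with h' | h' <;> simp [h, h']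

theorem orbitSign_congr {R R' : S.Λ} {j : ℕ} (h : ∀ k < j, S.code R k = S.code R' k) :
    S.orbitSign ε R j = S.orbitSign ε R' j :=
  Finset.prod_congr rfl fun k hk => by rw [h k (Finset.mem_range.1 hk)]

/-- Two points with the same symbols are moved by the same monotone maps, so their order is kept or
reversed according to the product of the orientations. -/
theorem orbitSign_mul_height_nonneg (hε : ∀ i, ε i = 1 ∨ ε i = -1)
    (hf : ∀ i, ∀ x ∈ Icc (0 : ℝ) 1, ∀ y ∈ Icc (0 : ℝ) 1, x ≤ y → 0 ≤ ε i * (S.f i y - S.f i x))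
    {R R' : S.Λ} (hle : S.height R ≤ S.height R') {j : ℕ}
    (h : ∀ k < j, S.code R k = S.code R' k) :
    0 ≤ S.orbitSign ε R j * (S.height (S.FΛ^[j] R') - S.height (S.FΛ^[j] R)) := by
  induction j with
  | zero => simpa [orbitSign] using hle
  | succ j ih =>
    have ih := ih fun k hk => h k (hk.trans (Nat.lt_succ_self j))
    rw [Function.iterate_succ_apply', Function.iterate_succ_apply', height_FΛ, height_FΛ,
      code_iterate, code_iterate, zero_add, ← h j (Nat.lt_succ_self j), orbitSign,
      Finset.prod_range_succ]
    rcases orbitSign_eq hε R j with h1 | h1 <;> rw [h1] at ih <;> rw [orbitSign] at h1 <;> rw [h1]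
    · have := hf (S.code R j) _ (S.height_mem (S.FΛ^[j] R)) _ (S.height_mem (S.FΛ^[j] R'))
        (by linarith)
      linarith
    · have := hf (S.code R j) _ (S.height_mem (S.FΛ^[j] R')) _ (S.height_mem (S.FΛ^[j] R))
        (by linarith)
      linarith

open Classical in
/-- The number of times `j < n` at which the orbit is, up to orientation, below the level `q`. -/
noncomputable def belowCount (ε : Fin 3 → ℝ) (q : ℝ) (n : ℕ) (R : S.Λ) : Fin (n + 1) :=
  ⟨(Finset.univ.filter fun j : Fin n =>
      (S.height (S.FΛ^[j] R) < q ↔ S.orbitSign ε R j = 1)).card,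
    Nat.lt_succ_of_le ((Finset.card_filter_le _ _).trans_eq (Finset.card_fin n))⟩

/-- For a fixed symbol word, the set of times counted by `belowCount` shrinks as the initial height
grows. These sets form a chain, so each is determined by its cardinality. -/
theorem below_iff_of_belowCount_eq (hε : ∀ i, ε i = 1 ∨ ε i = -1)
    (hf : ∀ i, ∀ x ∈ Icc (0 : ℝ) 1, ∀ y ∈ Icc (0 : ℝ) 1, x ≤ y → 0 ≤ ε i * (S.f i y - S.f i x))
    {q : ℝ} {n : ℕ} {R R' : S.Λ} (hcount : belowCount ε q n R = belowCount ε q n R')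
    (h : ∀ k < n, S.code R k = S.code R' k) (j : ℕ) (hj : j < n) :
    S.height (S.FΛ^[j] R) < q ↔ S.height (S.FΛ^[j] R') < q := by
  classical
  wlog hle : S.height R ≤ S.height R' generalizing R R'
  · exact (this hcount.symm (fun k hk => (h k hk).symm) (le_of_not_ge hle)).symm
  have hs : ∀ j < n, S.orbitSign ε R j = S.orbitSign ε R' j := fun j hj =>
    orbitSign_congr fun k hk => h k (hk.trans hj)
  have hsub : (Finset.univ.filter fun j : Fin n =>
      (S.height (S.FΛ^[j] R') < q ↔ S.orbitSign ε R' j = 1)) ⊆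
      Finset.univ.filter fun j : Fin n =>
      (S.height (S.FΛ^[j] R) < q ↔ S.orbitSign ε R j = 1) := by
    intro j hj
    simp only [Finset.mem_filter, Finset.mem_univ, true_and] at hj ⊢
    have h0 := orbitSign_mul_height_nonneg hε hf hle (j := j) fun k hk => h k (hk.trans j.2)
    rw [← hs j j.2] at hj
    rcases orbitSign_eq hε R j with h1 | h1
    · rw [h1] at h0
      simp only [h1, iff_true] at hj ⊢
      linarith
    · rw [h1] at h0 hj
      rw [h1]
      norm_num at hj ⊢
      linarith
  have heq := Finset.eq_of_subset_of_card_le hsub (Fin.ext_iff.1 hcount).le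
  have := Finset.ext_iff.1 heq ⟨j, hj⟩
  simp only [Finset.mem_filter, Finset.mem_univ, true_and] at this
  rw [hs j hj] at this
  tauto

/-! ### Generators of the σ-algebra have zero entropy relative to the symbols. -/

variable (S)

theorem measurable_code_apply (i : ℤ) : Measurable fun R : S.Λ => S.code R i :=
  measurable_pi_iff.1 S.measurable_code i

variable {μ : Measure S.Λ} [IsProbabilityMeasure μ]

/-- Moving a window of n symbols by one place brings in one new symbol, at a cost of at most log 3.
Reaching position i thus costs an amount independent of n. -/
theorem hasZeroRelEntropy_code (i : ℤ) :
    HasZeroRelEntropy μ S.FΛ (fun R => S.code R 0) fun R => S.code R i := by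
  have hm := fun (i : ℤ) n => measurable_itinerary S.measurable_FΛ (S.measurable_code_apply i) n
  suffices h : ∃ K : ℝ, ∀ n, condShannonEntropy μ (itinerary S.FΛ (fun R => S.code R i) n)
      (itinerary S.FΛ (fun R => S.code R 0) n) ≤ K by
    obtain ⟨K, hK⟩ := h
    exact .of_le S.measurable_FΛ (S.measurable_code_apply i) (S.measurable_code_apply 0)
      (tendsto_const_div_atTop_nhds_zero_nat K) hK
  -- Here l n is the position of the one symbol in the window starting at k that the window starting
  -- at i may lack.
  have hadj : ∀ (i k : ℤ) (l : ℤ → ℤ) (n : ℕ), (∀ R R' : S.Λ, S.code R (l n) = S.code R' (l n) →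
      (∀ j < n, S.code R (i + j) = S.code R' (i + j)) →
      ∀ j < n, S.code R (k + j) = S.code R' (k + j)) →
      condShannonEntropy μ (itinerary S.FΛ (fun R => S.code R k) n)
        (itinerary S.FΛ (fun R => S.code R i) n) ≤ Real.log 3 := by
    intro i k l n h
    refine (condShannonEntropy_mono_left (S.measurable_code_apply (l n)) (hm i n) ?_).trans
      ((condShannonEntropy_le_log_card (S.measurable_code_apply (l n)) (hm i n)).trans_eq (by simp))
    intro R R' h1 h2
    rw [itinerary_eq_iff] at h2 ⊢
    simp only [code_iterate] at h2 ⊢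
    exact h R R' h1 h2
  induction i using Int.induction_on with
  | zero =>
    exact ⟨0, fun n => (condShannonEntropy_eq_zero_of_factor (hm _ n) (hm _ n) fun _ _ => id).le⟩
  | succ i ih =>
    obtain ⟨K, hK⟩ := ih
    refine ⟨Real.log 3 + K, fun n => (condShannonEntropy_trans (hm _ n) (hm i n) (hm _ n)).trans
      (add_le_add (hadj i (i + 1) (fun n => i + n) n ?_) (hK n))⟩
    intro R R' h1 h2 j hj
    rcases (Nat.succ_le_of_lt hj).eq_or_lt with h3 | h3
    · convert h1 using 2 <;> omega
    · convert h2 (j + 1) h3 using 2 <;> push_cast <;> ring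
  | pred i ih =>
    obtain ⟨K, hK⟩ := ih
    refine ⟨Real.log 3 + K, fun n => (condShannonEntropy_trans (hm _ n) (hm (-i) n) (hm _ n)).trans
      (add_le_add (hadj (-i) (-i - 1) (fun _ => -i - 1) n ?_) (hK n))⟩
    intro R R' h1 h2 j hj
    rcases j.eq_zero_or_pos with rfl | h3
    · simpa using h1
    · convert h2 (j - 1) (by omega) using 2 <;> omega

/-- Given the symbols, the itinerary is a function of `belowCount`, which takes n + 1 values; its
conditional entropy is at most log(n + 1). -/
theorem hasZeroRelEntropy_height_lt (q : ℝ) :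
    HasZeroRelEntropy μ S.FΛ (fun R => S.code R 0) fun R => S.height R < q := by
  obtain ⟨ε, hε, hf⟩ := S.exists_orientation
  have hA : Measurable fun R => S.height R < q :=
    (measurableSet_lt S.measurable_height measurable_const).mem
  refine .of_le S.measurable_FΛ hA (S.measurable_code_apply 0) tendsto_log_succ_div fun n => ?_
  have h1 := measurable_itinerary S.measurable_FΛ hA n
  have h2 := measurable_itinerary S.measurable_FΛ (S.measurable_code_apply 0) n
  have h3 : Measurable (belowCount (S := S) ε q n) := by
    refine (h1.prodMk h2).of_factor fun R R' h => ?_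
    obtain ⟨h4, h5⟩ := Prod.ext_iff.1 h
    simp only [itinerary_eq_iff, code_iterate, zero_add] at h4 h5
    simp only [belowCount, Fin.mk.injEq]
    congr 1
    refine Finset.filter_congr fun j _ => ?_
    rw [h4 j j.2, orbitSign_congr fun k hk => h5 k (hk.trans j.2)]
  refine (condShannonEntropy_mono_left h3 h2 fun R R' h h' => ?_).trans
    ((condShannonEntropy_le_log_card h3 h2).trans_eq (by simp))
  simp only [itinerary_eq_iff, code_iterate, zero_add] at h' ⊢
  exact fun j hj => propext (below_iff_of_belowCount_eq hε hf h h' j hj)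

variable {S}

/-- The entropy of an invariant measure is bounded by the entropies of the words read off by the
symbolic coding. -/
theorem measureEntropy_le_itinerary (hμ : MeasurePreserving S.FΛ μ μ) {m : ℕ} (hm : m ≠ 0) :
    measureEntropy μ S.FΛ ≤
      ((shannonEntropy μ (itinerary S.FΛ (fun R => S.code R 0) m) / m : ℝ) : EReal) := by
  refine measureEntropy_le hμ (S.measurable_code_apply 0) (S.borel_le ?_ ?_) hm
  · refine @measurable_pi_lambda _ _ _ (_) _ _ fun i => ?_
    refine @measurable_to_countable' _ _ _ _ (_) _ fun a => ?_
    refine ⟨S.measurable_code_apply i (measurableSet_singleton a), ?_⟩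
    exact (S.hasZeroRelEntropy_code i).of_factor S.measurable_FΛ (S.measurable_code_apply i)
      (S.measurable_code_apply i (measurableSet_singleton a)).mem (S.measurable_code_apply 0)
      fun R R' h => by simp only [mem_preimage, h]
  · refine @measurable_of_Iio _ _ _ _ _ (_) _ _ _ _ fun q => ?_
    exact ⟨S.measurable_height measurableSet_Iio, S.hasZeroRelEntropy_height_lt q⟩

end HorseshoeSkewProduct

/-! ### The uniform Bernoulli measure of the full shift -/

/-- The uniform probability measure on three symbols. -/
noncomputable def uniformThree : Measure (Fin 3) := (PMF.uniformOfFintype (Fin 3)).toMeasure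

instance : IsProbabilityMeasure uniformThree := by
  unfold uniformThree
  infer_instance

theorem uniformThree_singleton (i : Fin 3) : uniformThree {i} = 3⁻¹ := by
  rw [uniformThree, PMF.toMeasure_apply_singleton _ _ (measurableSet_singleton i)]
  simp

/-- The uniform Bernoulli measure on bi-infinite sequences of three symbols. -/
noncomputable def bernoulliThree : Measure (ℤ → Fin 3) := Measure.infinitePi fun _ => uniformThree

instance : IsProbabilityMeasure bernoulliThree := by
  unfold bernoulliThree
  infer_instance

theorem bernoulliThree_cylinder {n : ℕ} (e : Fin n ↪ ℤ) (w : Fin n → Fin 3) :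
    bernoulliThree {ξ | ∀ j, ξ (e j) = w j} = 3⁻¹ ^ n := by
  have h : {ξ : ℤ → Fin 3 | ∀ j, ξ (e j) = w j} = Set.pi (Finset.univ.map e : Finset ℤ)
      (Function.extend e (fun j => {w j}) fun _ => univ) := by
    ext ξ
    simp [Set.mem_pi, e.injective.extend_apply]
  rw [h, bernoulliThree, Measure.infinitePi_pi _ fun _ _ => .of_discrete, Finset.prod_map]
  simp [e.injective.extend_apply, uniformThree_singleton]

/-- The word of length `n` read off at position `a`. -/
def wordAt (a : ℤ) (n : ℕ) (ξ : ℤ → Fin 3) : Fin n → Fin 3 := fun j => ξ (a + j)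

theorem measurable_wordAt (a : ℤ) (n : ℕ) : Measurable (wordAt a n) :=
  measurable_pi_iff.2 fun j => measurable_pi_apply (a + j)

theorem bernoulliThree_wordAt (a : ℤ) (n : ℕ) (w : Fin n → Fin 3) :
    bernoulliThree (wordAt a n ⁻¹' {w}) = 3⁻¹ ^ n := by
  rw [← bernoulliThree_cylinder ⟨fun j : Fin n => a + j, fun i j h => Fin.ext (by simpa using h)⟩ w]
  congr 1
  ext ξ
  simp only [mem_preimage, mem_singleton_iff, funext_iff, mem_ofPred_eq]
  rfl

/-- A measure for which all words of the same length are equally likely is Bernoulli. -/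
theorem eq_bernoulliThree {μ : Measure (ℤ → Fin 3)}
    (h : ∀ a n w, μ (wordAt a n ⁻¹' {w}) = 3⁻¹ ^ n) : μ = bernoulliThree := by
  have hmap : ∀ a n, μ.map (wordAt a n) = bernoulliThree.map (wordAt a n) := fun a n => by
    refine Measure.ext_of_singleton fun w => ?_
    rw [Measure.map_apply (measurable_wordAt a n) (measurableSet_singleton w),
      Measure.map_apply (measurable_wordAt a n) (measurableSet_singleton w), h,
      bernoulliThree_wordAt]
  refine Measure.eq_infinitePi _ fun s t ht => ?_
  rw [← Measure.infinitePi_pi _ fun i _ => ht i]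
  change _ = bernoulliThree _
  -- A condition on finitely many coordinates is a condition on the word of length 2m + 1 read on
  -- [-m, m].
  obtain ⟨m, hm⟩ : ∃ m : ℕ, ∀ i ∈ s, i.natAbs ≤ m :=
    ⟨s.sup Int.natAbs, fun i hi => Finset.le_sup (f := Int.natAbs) hi⟩
  have hbox : Set.pi (s : Set ℤ) t = wordAt (-m) (2 * m + 1) ⁻¹'
      {w | ∀ j : Fin (2 * m + 1), (-m + j : ℤ) ∈ s → w j ∈ t (-m + j)} := by
    ext ξ
    constructor
    · exact fun hξ j hj => hξ _ hj
    · intro hξ i hi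
      have := hm i hi
      have := hξ ⟨(i + m).toNat, by omega⟩
      have hi' : (-m + ((i + m).toNat : ℕ) : ℤ) = i := by omega
      simp only [wordAt, hi'] at this
      exact this hi
  have hB : MeasurableSet
      {w : Fin (2 * m + 1) → Fin 3 | ∀ j : Fin (2 * m + 1), (-m + j : ℤ) ∈ s →
        w j ∈ t (-m + j)} :=
    (Set.toFinite _).measurableSet
  rw [hbox, ← Measure.map_apply (measurable_wordAt _ _) hB, hmap,
    Measure.map_apply (measurable_wordAt _ _) hB]

theorem measurable_bishift : Measurable bishift :=
  measurable_pi_iff.2 fun n => measurable_pi_apply (n + 1)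

theorem measurePreserving_bishift : MeasurePreserving bishift bernoulliThree bernoulliThree := by
  refine ⟨measurable_bishift, eq_bernoulliThree fun a n w => ?_⟩
  rw [Measure.map_apply measurable_bishift (measurable_wordAt a n (measurableSet_singleton w)),
    ← bernoulliThree_wordAt (a + 1) n w]
  congr 1
  ext ξ
  simp [wordAt, bishift, funext_iff, add_right_comm]

theorem integral_uniformThree (g : Fin 3 → ℝ) : ∫ i, g i ∂uniformThree = (∑ i, g i) / 3 := by
  rw [integral_fintype (Integrable.of_finite), Finset.sum_div]
  refine Finset.sum_congr rfl fun i _ => ?_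
  rw [measureReal_def, uniformThree_singleton]
  simp
  ring

/-- Along the past of a typical sequence the Birkhoff sums of an observable of negative mean
diverge to `-∞`. -/
theorem ae_tendsto_sum_past (g : Fin 3 → ℝ) (hg : ∑ i, g i < 0) :
    ∀ᵐ ξ ∂bernoulliThree, ∀ m : ℤ,
      Tendsto (fun n : ℕ => ∑ k ∈ Finset.range n, g (ξ (m - 1 - k))) atTop atBot := by
  rw [ae_all_iff]
  intro m
  have hmeas : Measurable g := .of_discrete
  have hmp : ∀ i : ℤ, MeasurePreserving (fun ξ : ℤ → Fin 3 => ξ i) bernoulliThree uniformThree :=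
    fun i => measurePreserving_eval_infinitePi _ i
  have hint : ∫ ξ, g (ξ (m - 1 - (0 : ℕ))) ∂bernoulliThree = (∑ i, g i) / 3 := by
    rw [← integral_uniformThree, ← (hmp (m - 1 - (0 : ℕ))).map_eq,
      integral_map (hmp _).measurable.aemeasurable hmeas.aestronglyMeasurable]
  have hindep : ProbabilityTheory.iIndepFun (fun (i : ℤ) (ξ : ℤ → Fin 3) => g (ξ i))
      bernoulliThree :=
    ProbabilityTheory.iIndepFun_infinitePi (P := fun _ => uniformThree) (X := fun _ => g)
      fun _ => hmeas
  have hslln := ProbabilityTheory.strong_law_ae_real (μ := bernoulliThree)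
    (fun k ξ => g (ξ (m - 1 - k))) ?_ ?_ ?_
  · filter_upwards [hslln] with ξ hξ
    rw [hint] at hξ
    -- The averages converge to a negative mean; multiplying back by n gives divergence to -∞.
    have h1 := hξ.neg_mul_atTop (by linarith) tendsto_natCast_atTop_atTop
    refine h1.congr' ?_
    filter_upwards [eventually_ne_atTop 0] with n hn
    field_simp
  · exact (hmp _).integrable_comp_of_integrable Integrable.of_finite
  · intro i j hij
    exact hindep.indepFun (by simpa using hij)
  · intro i
    refine ⟨(hmeas.comp (hmp _).measurable).aemeasurable,
      (hmeas.comp (hmp _).measurable).aemeasurable, ?_⟩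
    have hlaw : ∀ i : ℤ, bernoulliThree.map (fun ξ => g (ξ i)) = uniformThree.map g := fun i => by
      rw [← (hmp i).map_eq, Measure.map_map hmeas (hmp i).measurable]
      rfl
    rw [hlaw, hlaw]

/-! ### Contraction of the fibers along typical orbits -/

/-- Along the past of every point of the orbit of `ξ` the sums of `g` diverge to `-∞`. -/
def PastDiverges (g : Fin 3 → ℝ) (ξ : ℤ → Fin 3) : Prop :=
  ∀ m : ℤ, Tendsto (fun n : ℕ => ∑ k ∈ Finset.range n, g (ξ (m - 1 - k))) atTop atBot

/-- Quantifying over all times m makes the condition shift invariant, so that whole orbits can be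
lifted at once. -/
theorem PastDiverges.shift {g : Fin 3 → ℝ} {ξ : ℤ → Fin 3} (h : PastDiverges g ξ) (n : ℤ) :
    PastDiverges g fun i => ξ (i + n) := fun m => by
  refine (h (m + n)).congr fun k => Finset.sum_congr rfl fun j _ => ?_
  congr 2
  ring

theorem measurableSet_pastDiverges (g : Fin 3 → ℝ) : MeasurableSet {ξ | PastDiverges g ξ} := by
  have hg : Measurable g := .of_discrete
  simp only [PastDiverges, ofPred_forall]
  refine MeasurableSet.iInter fun m => measurableSet_tendsto _ fun n => ?_
  exact Finset.measurable_sum _ fun k _ => hg.comp (measurable_pi_apply _)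

namespace HorseshoeSkewProduct

variable (S : HorseshoeSkewProduct)

/-- The composition of the fiber maps along the past of `ξ` of length `n`. -/
noncomputable def branch (ξ : ℤ → Fin 3) : ℕ → ℝ → ℝ
  | 0, x => x
  | n + 1, x => branch ξ n (S.f (ξ (-1 - n)) x)

theorem branch_mem (ξ : ℤ → Fin 3) (n : ℕ) {x : ℝ} (hx : x ∈ Icc (0 : ℝ) 1) :
    S.branch ξ n x ∈ Icc (0 : ℝ) 1 := by
  induction n generalizing x with
  | zero => exact hx
  | succ n ih => exact ih (S.mapsTo _ hx)

/-- The oldest map acts first, so a longer branch is the shorter one applied to a later point of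
[0,1]: the images of the fiber are nested. -/
theorem exists_branch_add (ξ : ℤ → Fin 3) (n k : ℕ) {x : ℝ} (hx : x ∈ Icc (0 : ℝ) 1) :
    ∃ y ∈ Icc (0 : ℝ) 1, S.branch ξ (n + k) x = S.branch ξ n y := by
  induction k generalizing x with
  | zero => exact ⟨x, hx, rfl⟩
  | succ k ih => exact ih (S.mapsTo _ hx)

theorem branch_bishift (ξ : ℤ → Fin 3) (n : ℕ) (x : ℝ) :
    S.branch (bishift ξ) (n + 1) x = S.f (ξ 0) (S.branch ξ n x) := by
  induction n generalizing x with
  | zero => simp [branch, bishift]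
  | succ n ih =>
    rw [branch, ih]
    have : bishift ξ (-1 - (n + 1 : ℕ)) = ξ (-1 - n) := by
      simp only [bishift]
      congr 1
      push_cast
      ring
    rw [this]
    rfl

theorem measurable_branch (n : ℕ) (x : ℝ) : Measurable fun ξ => S.branch ξ n x := by
  induction n generalizing x with
  | zero => exact measurable_const
  | succ n ih =>
    have h : Measurable fun p : Fin 3 × (ℤ → Fin 3) => S.branch p.2 n (S.f p.1 x) :=
      measurable_from_prod_countable_right fun i => ih (S.f i x)
    have h' : Measurable fun ξ : ℤ → Fin 3 => (ξ (-1 - n), ξ) :=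
      (measurable_pi_apply _).prodMk measurable_id
    exact h.comp h'

/-- The point selected in the fiber over `ξ`. -/
noncomputable def fiberPoint (ξ : ℤ → Fin 3) : ℝ := limsup (fun n => S.branch ξ n 0) atTop

/-- Choosing the limsup gives a measurable function on all sequences, including those along which
the branches do not converge. -/
theorem measurable_fiberPoint : Measurable S.fiberPoint :=
  Measurable.limsup fun n => S.measurable_branch n 0

variable {S} {L : Fin 3 → ℝ}

theorem abs_f_sub_le (hL : ∀ i, ∀ x ∈ Icc (0 : ℝ) 1, |fiberDeriv S.f i x| ≤ L i) (i : Fin 3)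
    {x y : ℝ} (hx : x ∈ Icc (0 : ℝ) 1) (hy : y ∈ Icc (0 : ℝ) 1) :
    |S.f i x - S.f i y| ≤ L i * |x - y| :=
  (convex_Icc 0 1).norm_image_sub_le_of_norm_derivWithin_le
    ((S.contDiffOn i).differentiableOn one_ne_zero) (hL i) hy hx

theorem rate_pos (hL : ∀ i, ∀ x ∈ Icc (0 : ℝ) 1, |fiberDeriv S.f i x| ≤ L i) (i : Fin 3) :
    0 < L i :=
  (S.contracting i).1.trans <| (S.dominated i i 0 (by simp)).1.trans_le (hL i 0 (by simp))

theorem abs_branch_sub_le (hL : ∀ i, ∀ x ∈ Icc (0 : ℝ) 1, |fiberDeriv S.f i x| ≤ L i)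
    (ξ : ℤ → Fin 3) (n : ℕ) {x y : ℝ} (hx : x ∈ Icc (0 : ℝ) 1) (hy : y ∈ Icc (0 : ℝ) 1) :
    |S.branch ξ n x - S.branch ξ n y| ≤ ∏ k ∈ Finset.range n, L (ξ (-1 - k)) := by
  -- The factor |x - y| ≤ 1 is kept for the induction and dropped at the end.
  suffices h : |S.branch ξ n x - S.branch ξ n y| ≤
      (∏ k ∈ Finset.range n, L (ξ (-1 - k))) * |x - y| by
    refine h.trans (mul_le_of_le_one_right (Finset.prod_nonneg fun k _ => (rate_pos hL _).le) ?_)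
    rw [abs_le]
    constructor <;> linarith [hx.1, hx.2, hy.1, hy.2]
  induction n generalizing x y with
  | zero => simp [branch]
  | succ n ih =>
    rw [Finset.prod_range_succ, mul_assoc]
    exact (ih (S.mapsTo _ hx) (S.mapsTo _ hy)).trans
      (mul_le_mul_of_nonneg_left (abs_f_sub_le hL _ hx hy)
        (Finset.prod_nonneg fun k _ => (rate_pos hL _).le))

theorem tendsto_prod_rate (hL : ∀ i, ∀ x ∈ Icc (0 : ℝ) 1, |fiberDeriv S.f i x| ≤ L i)
    {ξ : ℤ → Fin 3} (hξ : PastDiverges (fun i => Real.log (L i)) ξ) :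
    Tendsto (fun n : ℕ => ∏ k ∈ Finset.range n, L (ξ (-1 - k))) atTop (nhds 0) := by
  refine (Real.tendsto_exp_atBot.comp (hξ 0)).congr fun n => ?_
  rw [Function.comp, Real.exp_sum]
  refine Finset.prod_congr rfl fun k _ => ?_
  rw [Real.exp_log (rate_pos hL _), zero_sub]

/-- The fiber over a sequence with contracting past shrinks to a single point. -/
theorem tendsto_branch (hL : ∀ i, ∀ x ∈ Icc (0 : ℝ) 1, |fiberDeriv S.f i x| ≤ L i)
    {ξ : ℤ → Fin 3} (hξ : PastDiverges (fun i => Real.log (L i)) ξ) {y : ℕ → ℝ}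
    (hy : ∀ n, y n ∈ Icc (0 : ℝ) 1) :
    Tendsto (fun n => S.branch ξ n (y n)) atTop (nhds (S.fiberPoint ξ)) := by
  have h0 : (0 : ℝ) ∈ Icc (0 : ℝ) 1 := by simp
  have hprod := tendsto_prod_rate hL hξ
  -- By nestedness, all later branch values lie in the N-th image of the fiber, whose diameter is at
  -- most the product of the first N rates.
  have hnear : ∀ N n, N ≤ n → |S.branch ξ n 0 - S.branch ξ N 0| ≤
      ∏ k ∈ Finset.range N, L (ξ (-1 - k)) := by
    intro N n hn
    obtain ⟨k, rfl⟩ := Nat.exists_eq_add_of_le hn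
    obtain ⟨z, hz, hz'⟩ := S.exists_branch_add ξ N k h0
    rw [hz']
    exact abs_branch_sub_le hL ξ N hz h0
  have hcau : CauchySeq fun n => S.branch ξ n 0 := by
    refine cauchySeq_of_le_tendsto_0 (fun N => 2 * ∏ k ∈ Finset.range N, L (ξ (-1 - k)))
      (fun n m N hn hm => ?_) (by simpa using hprod.const_mul 2)
    rw [two_mul]
    refine (dist_triangle_right _ _ (S.branch ξ N 0)).trans (add_le_add ?_ ?_)
    · exact hnear N n hn
    · exact hnear N m hm
  obtain ⟨l, hl⟩ := cauchySeq_tendsto_of_complete hcau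
  rw [fiberPoint, hl.limsup_eq]
  have hdiff : Tendsto (fun n => S.branch ξ n (y n) - S.branch ξ n 0) atTop (nhds 0) :=
    squeeze_zero_norm (fun n => abs_branch_sub_le hL ξ n (hy n) h0) hprod
  simpa using hdiff.add hl

theorem fiberPoint_mem (hL : ∀ i, ∀ x ∈ Icc (0 : ℝ) 1, |fiberDeriv S.f i x| ≤ L i)
    {ξ : ℤ → Fin 3} (hξ : PastDiverges (fun i => Real.log (L i)) ξ) :
    S.fiberPoint ξ ∈ Icc (0 : ℝ) 1 :=
  isClosed_Icc.mem_of_tendsto (tendsto_branch hL hξ (y := fun _ => 0) (by simp))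
    (Eventually.of_forall fun n => S.branch_mem ξ n (by simp))

theorem fiberPoint_bishift (hL : ∀ i, ∀ x ∈ Icc (0 : ℝ) 1, |fiberDeriv S.f i x| ≤ L i)
    {ξ : ℤ → Fin 3} (hξ : PastDiverges (fun i => Real.log (L i)) ξ) :
    S.fiberPoint (bishift ξ) = S.f (ξ 0) (S.fiberPoint ξ) := by
  have h1 := tendsto_branch hL (hξ.shift 1) (y := fun _ => 0) (by simp)
  have h2 := (tendsto_add_atTop_iff_nat 1).2 h1
  have h3 := tendsto_branch hL hξ (y := fun _ => 0) (by simp)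
  have h4 : Tendsto (fun n => S.f (ξ 0) (S.branch ξ n 0)) atTop
      (nhds (S.f (ξ 0) (S.fiberPoint ξ))) :=
    ((S.contDiffOn (ξ 0)).continuousOn _ (fiberPoint_mem hL hξ)).tendsto.comp <|
      tendsto_nhdsWithin_iff.2 ⟨h3, Eventually.of_forall fun n => S.branch_mem ξ n (by simp)⟩
  refine tendsto_nhds_unique h2 (h4.congr fun n => ?_)
  rw [← branch_bishift]
  rfl

variable (S) in
/-- The selected point over `ξ` in the cube. -/
noncomputable def lift (ξ : ℤ → Fin 3) : (ℝ × ℝ) × ℝ := ((S.ϖ.symm ξ : ℝ × ℝ), S.fiberPoint ξ)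

variable (S) in
theorem measurable_lift : Measurable S.lift := by
  have h : Measurable fun ξ => (S.ϖ.symm ξ : ℝ × ℝ) :=
    (continuous_subtype_val.comp S.ϖ.symm.continuous).measurable
  exact h.prodMk S.measurable_fiberPoint

theorem F_lift (hL : ∀ i, ∀ x ∈ Icc (0 : ℝ) 1, |fiberDeriv S.f i x| ≤ L i)
    {ξ : ℤ → Fin 3} (hξ : PastDiverges (fun i => Real.log (L i)) ξ) :
    S.F (S.lift ξ) = S.lift (bishift ξ) := by
  rw [F, lift, lift, S.ϖ_symm_bishift, fiberPoint_bishift hL hξ, S.symbol_eq (S.ϖ_symm_mem_leg ξ)]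

theorem lift_mem_Λ (hL : ∀ i, ∀ x ∈ Icc (0 : ℝ) 1, |fiberDeriv S.f i x| ≤ L i)
    {ξ : ℤ → Fin 3} (hξ : PastDiverges (fun i => Real.log (L i)) ξ) : S.lift ξ ∈ S.Λ := by
  refine ⟨fun n => S.lift fun i => ξ (i + n), by simp, fun n => ⟨?_, ?_⟩⟩
  · exact mem_domain (S.ϖ_symm_mem_leg _) (fiberPoint_mem hL (hξ.shift n))
  · rw [F_lift hL (hξ.shift n)]
    congr 1
    funext i
    simp only [bishift]
    congr 1
    ring

/-- Along any full orbit through R, the height is the branch of length n applied to the height n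
steps earlier, for every n. The limit does not depend on those past heights. -/
theorem height_eq_fiberPoint (hL : ∀ i, ∀ x ∈ Icc (0 : ℝ) 1, |fiberDeriv S.f i x| ≤ L i)
    {R : S.Λ} (hR : PastDiverges (fun i => Real.log (L i)) (S.code R)) :
    S.height R = S.fiberPoint (S.code R) := by
  obtain ⟨z, hz0, hz⟩ := R.2
  have hleg : ∀ n, (z n).1 ∈ S.leg (S.code R n) := fun n => by
    rw [S.orbit_fst hz n, hz0]
    exact S.coding _ n
  have hIcc : ∀ n, (z n).2 ∈ Icc (0 : ℝ) 1 := fun n => by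
    obtain ⟨i, -, hi⟩ := mem_iUnion.1 (hz n).1
    exact hi
  have hbranch : ∀ n : ℕ, S.branch (S.code R) n (z (-n)).2 = S.height R := by
    intro n
    induction n with
    | zero => simp [branch, height, hz0]
    | succ n ih =>
      rw [← ih, branch]
      congr 1
      have h1 := (hz (-(n + 1 : ℕ))).2
      have h2 : (-(n + 1 : ℕ) : ℤ) + 1 = -n := by push_cast; ring
      have h3 : (-(n + 1 : ℕ) : ℤ) = -1 - n := by push_cast; ring
      rw [h2] at h1
      rw [← h1, h3, F, S.symbol_eq (hleg _)]
  have h := tendsto_branch hL hR (y := fun n => (z (-n)).2) fun n => hIcc _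
  simp only [hbranch] at h
  exact tendsto_nhds_unique tendsto_const_nhds h

end HorseshoeSkewProduct

/-! ### Measures of maximal entropy -/

theorem ae_pastDiverges {L : Fin 3 → ℝ} (hneg : ∑ i, Real.log (L i) < 0) :
    ∀ᵐ ξ ∂bernoulliThree, PastDiverges (fun i => Real.log (L i)) ξ := by
  simpa only [PastDiverges] using ae_tendsto_sum_past (fun i => Real.log (L i)) hneg

/-- Upper bounds for the derivatives of the fiber maps. -/
noncomputable def fiberRate (f : Fin 3 → ℝ → ℝ) (γ : ℝ) (i : Fin 3) : ℝ :=
  if i = 1 then γ else betaPlus f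

theorem fiberDeriv_one {f : Fin 3 → ℝ → ℝ} {γ : ℝ} (h : CondF1 f γ) {x : ℝ}
    (hx : x ∈ Icc (0 : ℝ) 1) : fiberDeriv f 1 x = -γ := by
  rw [fiberDeriv, derivWithin_congr h.eq (h.eq x hx)]
  have : HasDerivAt (fun x : ℝ => γ * (1 - x)) (γ * -1) x :=
    ((hasDerivAt_id x).const_sub 1).const_mul γ
  rw [this.hasDerivWithinAt.derivWithin (uniqueDiffOn_Icc zero_lt_one x hx)]
  ring

theorem abs_fiberDeriv_le_fiberRate {f : Fin 3 → ℝ → ℝ} {γ : ℝ} (hF0 : CondF0 f)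
    (hF1 : CondF1 f γ) (hF2 : CondF2 f) (hbound : CondDerivBound f) (i : Fin 3) (x : ℝ)
    (hx : x ∈ Icc (0 : ℝ) 1) : |fiberDeriv f i x| ≤ fiberRate f γ i := by
  fin_cases i
  · change |fiberDeriv f 0 x| ≤ fiberRate f γ 0
    have h : 0 ≤ fiberDeriv f 0 x := hF0.strictMono.monotoneOn.derivWithin_nonneg
    rw [abs_of_nonneg h]
    simpa [fiberRate] using hbound.zero_le x hx
  · change |fiberDeriv f 1 x| ≤ fiberRate f γ 1
    rw [fiberDeriv_one hF1 hx, abs_neg, abs_of_pos hF1.pos]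
    simp [fiberRate]
  · change |fiberDeriv f 2 x| ≤ fiberRate f γ 2
    have h : 0 ≤ fiberDeriv f 2 x := hF2.strictMono.monotoneOn.derivWithin_nonneg
    rw [abs_of_nonneg h]
    simpa [fiberRate] using hbound.two_le x hx

/-- Symbols 0 and 2 each contribute log β₀₂⁺ and symbol 1 contributes log γ, so the hypothesis γ
(β₀₂⁺)² < 1 is exactly contraction on average. -/
theorem sum_log_fiberRate_neg {f : Fin 3 → ℝ → ℝ} {γ : ℝ} (hF0 : CondF0 f)
    (hF1 : CondF1 f γ) (hγ : γ * betaPlus f ^ 2 < 1) : ∑ i, Real.log (fiberRate f γ i) < 0 := by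
  have hβ : 0 < betaPlus f := zero_lt_one.trans (hF0.repelling.trans_le (le_max_left _ _))
  have h : ∑ i, Real.log (fiberRate f γ i) = Real.log (γ * betaPlus f ^ 2) := by
    rw [Real.log_mul hF1.pos.ne' (by positivity), Real.log_pow, Fin.sum_univ_three]
    simp [fiberRate]
    ring
  rw [h]
  exact Real.log_neg (mul_pos hF1.pos (by positivity)) hγ

namespace HorseshoeSkewProduct

variable {S : HorseshoeSkewProduct} {μ : Measure S.Λ}

theorem itinerary_code (R : S.Λ) (n : ℕ) :
    itinerary S.FΛ (fun R => S.code R 0) n R = wordAt 0 n (S.code R) := by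
  funext j
  simp [itinerary, code_iterate, wordAt]

theorem measureReal_itinerary_code (n : ℕ) (w : Fin n → Fin 3) :
    μ.real (itinerary S.FΛ (fun R => S.code R 0) n ⁻¹' {w}) =
      (μ.map S.code).real (wordAt 0 n ⁻¹' {w}) := by
  rw [map_measureReal_apply S.measurable_code (measurable_wordAt 0 n (measurableSet_singleton w))]
  congr 1
  ext R
  simp [itinerary_code]

theorem card_words (n : ℕ) : (Fintype.card (Fin n → Fin 3) : ℝ) = 3 ^ n := by simp

theorem measureEntropy_le_log_three (hμ : IsInvariantProbability S.FΛ μ) :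
    measureEntropy μ S.FΛ ≤ (Real.log 3 : ℝ) := by
  have := hμ.1
  refine (measureEntropy_le_itinerary hμ.2 one_ne_zero).trans (EReal.coe_le_coe_iff.2 ?_)
  have h := shannonEntropy_le_log_card (μ := μ)
    (measurable_itinerary S.measurable_FΛ (S.measurable_code_apply 0) 1)
  rw [card_words] at h
  simpa using h

/-- The partition by the symbol at time 0 suffices: its 3ⁿ words are equally likely, so its n-step
entropy is n log 3. -/
theorem log_three_le_measureEntropy [IsProbabilityMeasure μ]
    (hcode : μ.map S.code = bernoulliThree) :
    ((Real.log 3 : ℝ) : EReal) ≤ measureEntropy μ S.FΛ := by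
  refine le_trans ?_ (le_iSup₂_of_le 3 (fun R => S.code R 0)
    (le_iSup_of_le (S.measurable_code_apply 0) le_rfl))
  have h : ∀ n : ℕ, n ≠ 0 →
      itineraryEntropy μ S.FΛ (fun R => S.code R 0) n / n = Real.log 3 := by
    intro n hn
    have h1 : itineraryEntropy μ S.FΛ (fun R => S.code R 0) n =
        shannonEntropy μ (itinerary S.FΛ (fun R => S.code R 0) n) := by
      refine Finset.sum_congr rfl fun w _ => ?_
      congr 2
      ext x
      simp [itinerary, funext_iff]
    have hn' : (n : ℝ) ≠ 0 := by exact_mod_cast hn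
    rw [h1, shannonEntropy_eq_log_card_of_uniform fun w => ?_, card_words, Real.log_pow]
    · field_simp
    · rw [measureReal_itinerary_code, hcode, measureReal_def, bernoulliThree_wordAt, card_words]
      simp
  refine (Tendsto.limsup_eq ?_).ge
  refine tendsto_const_nhds.congr' ?_
  filter_upwards [eventually_ne_atTop 0] with n hn
  rw [h n hn]

/-- A measure of entropy `log 3` projects to the uniform Bernoulli measure. -/
theorem map_code_eq_bernoulliThree (hμ : IsInvariantProbability S.FΛ μ)
    (h : ((Real.log 3 : ℝ) : EReal) ≤ measureEntropy μ S.FΛ) :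
    μ.map S.code = bernoulliThree := by
  have := hμ.1
  have hmap : IsProbabilityMeasure (μ.map S.code) :=
    Measure.isProbabilityMeasure_map S.measurable_code.aemeasurable
  have hw := fun a n (w : Fin n → Fin 3) => measurable_wordAt a n (measurableSet_singleton w)
  have hshift : ∀ a n w, (μ.map S.code) (wordAt (a + 1) n ⁻¹' {w}) =
      (μ.map S.code) (wordAt a n ⁻¹' {w}) := by
    intro a n w
    rw [Measure.map_apply S.measurable_code (hw _ _ _),
      Measure.map_apply S.measurable_code (hw _ _ _),
      ← hμ.2.measure_preimage (S.measurable_code (hw a n w)).nullMeasurableSet]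
    congr 1
    ext R
    simp [code_FΛ, bishift, wordAt, funext_iff, add_right_comm]
  refine eq_bernoulliThree fun a n w => ?_
  have hzero : (μ.map S.code) (wordAt 0 n ⁻¹' {w}) = 3⁻¹ ^ n := by
    -- Entropy at least log 3 forces the words of length n to have entropy at least n log 3, the
    -- maximum on 3ⁿ atoms, which only the uniform distribution attains.
    have h1 : (μ.map S.code).real (wordAt 0 n ⁻¹' {w}) = 1 / Fintype.card (Fin n → Fin 3) := by
      rw [← measureReal_itinerary_code]
      refine measureReal_eq_of_log_card_le
        (measurable_itinerary S.measurable_FΛ (S.measurable_code_apply 0) n) ?_ w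
      rw [card_words, Real.log_pow]
      rcases n.eq_zero_or_pos with rfl | hn
      · simp only [Nat.cast_zero, zero_mul]
        exact Finset.sum_nonneg fun a _ =>
          Real.negMulLog_nonneg measureReal_nonneg measureReal_le_one
      · have h2 := EReal.coe_le_coe_iff.1 (h.trans (measureEntropy_le_itinerary hμ.2 hn.ne'))
        rw [le_div_iff₀ (by exact_mod_cast hn)] at h2
        linarith
    rw [← ENNReal.toReal_eq_toReal_iff' (measure_ne_top _ _) (by simp), ← measureReal_def, h1,
      card_words]
    simp
  induction a using Int.induction_on with
  | zero => exact hzero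
  | succ a ih => rw [hshift, ih]
  | pred a ih => rw [← hshift, sub_add_cancel, ih]

/-! ### Existence and uniqueness of the lift of the Bernoulli measure. -/

section Lift

variable {L : Fin 3 → ℝ}

/-- Off the full-measure set of contracting pasts the selected point may leave Λ; there it is
replaced by the lift of one fixed good sequence. -/
theorem exists_lift (hL : ∀ i, ∀ x ∈ Icc (0 : ℝ) 1, |fiberDeriv S.f i x| ≤ L i)
    (hneg : ∑ i, Real.log (L i) < 0) :
    ∃ s : (ℤ → Fin 3) → S.Λ, Measurable s ∧
      ∀ ξ, PastDiverges (fun i => Real.log (L i)) ξ → (s ξ : (ℝ × ℝ) × ℝ) = S.lift ξ := by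
  classical
  obtain ⟨ξ₀, hξ₀⟩ := (ae_pastDiverges hneg).exists
  refine ⟨fun ξ => ⟨if PastDiverges (fun i => Real.log (L i)) ξ then S.lift ξ else S.lift ξ₀, ?_⟩,
    ?_, fun ξ hξ => if_pos hξ⟩
  · split_ifs with h
    · exact lift_mem_Λ hL h
    · exact lift_mem_Λ hL hξ₀
  · exact (Measurable.ite (measurableSet_pastDiverges _) S.measurable_lift
      measurable_const).subtype_mk

theorem code_of_coe_eq_lift {R : S.Λ} {ξ : ℤ → Fin 3} (h : (R : (ℝ × ℝ) × ℝ) = S.lift ξ) :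
    S.code R = ξ := by
  rw [code, ← S.ϖ.apply_symm_apply ξ]
  congr 1
  exact Subtype.ext (congrArg Prod.fst h)

/-- The Bernoulli measure lifts to an invariant measure. -/
theorem exists_invariant_lift (hL : ∀ i, ∀ x ∈ Icc (0 : ℝ) 1, |fiberDeriv S.f i x| ≤ L i)
    (hneg : ∑ i, Real.log (L i) < 0) :
    ∃ ν : Measure S.Λ, IsInvariantProbability S.FΛ ν ∧ ν.map S.code = bernoulliThree := by
  obtain ⟨s, hs, hslift⟩ := exists_lift hL hneg
  refine ⟨bernoulliThree.map s, ⟨Measure.isProbabilityMeasure_map hs.aemeasurable,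
    S.measurable_FΛ, ?_⟩, ?_⟩
  · rw [Measure.map_map S.measurable_FΛ hs]
    -- With the Bernoulli measure written as its own shift image, invariance reduces to FΛ ∘ s = s ∘
    -- bishift almost everywhere.
    conv_rhs => rw [← measurePreserving_bishift.map_eq, Measure.map_map hs measurable_bishift]
    refine Measure.map_congr ?_
    filter_upwards [ae_pastDiverges hneg] with ξ hξ
    refine Subtype.ext ?_
    have h1 : ((S.FΛ (s ξ) : S.Λ) : (ℝ × ℝ) × ℝ) = S.F (s ξ) := rfl
    rw [Function.comp, Function.comp, h1, hslift ξ hξ, F_lift hL hξ]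
    exact (hslift _ (hξ.shift 1)).symm
  · rw [Measure.map_map S.measurable_code hs]
    refine (Measure.map_congr ?_).trans Measure.map_id
    filter_upwards [ae_pastDiverges hneg] with ξ hξ
    exact code_of_coe_eq_lift (hslift ξ hξ)

/-- The Bernoulli measure has only one lift. -/
theorem eq_of_map_code_eq_bernoulliThree
    (hL : ∀ i, ∀ x ∈ Icc (0 : ℝ) 1, |fiberDeriv S.f i x| ≤ L i)
    (hneg : ∑ i, Real.log (L i) < 0) {ν : Measure S.Λ}
    (hμ : μ.map S.code = bernoulliThree) (hν : ν.map S.code = bernoulliThree) : μ = ν := by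
  obtain ⟨s, hs, hslift⟩ := exists_lift hL hneg
  -- Over contracting pasts the fiber is one point, so s ∘ code is the identity κ-almost everywhere,
  -- and κ is the image of its projection under s.
  suffices h : ∀ κ : Measure S.Λ, κ.map S.code = bernoulliThree → κ = bernoulliThree.map s from
    (h μ hμ).trans (h ν hν).symm
  intro κ hκ
  rw [← hκ, Measure.map_map hs S.measurable_code]
  refine Measure.map_id.symm.trans (Measure.map_congr ?_)
  have hae := ae_pastDiverges hneg
  rw [← hκ] at hae
  filter_upwards [ae_of_ae_map S.measurable_code.aemeasurable hae] with R hR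
  refine Subtype.ext ?_
  rw [Function.comp, hslift _ hR, lift, ϖ_symm_code, ← height_eq_fiberPoint hL hR]
  rfl

end Lift

/-- Along a fiber the base point is constant, so the derivative of F has zero base component and its
sup norm is the absolute fiber derivative. -/
theorem centralNorm_eq (R : S.Λ) :
    S.centralNorm R = |fiberDeriv S.f (S.code R 0) (S.height R)| := by
  have hx := S.height_mem R
  have h1 : HasDerivWithinAt (S.f (S.code R 0)) (fiberDeriv S.f (S.code R 0) (S.height R))
      (Icc 0 1) (S.height R) :=
    ((S.contDiffOn _).differentiableOn one_ne_zero _ hx).hasDerivWithinAt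
  have h2 := (hasDerivWithinAt_const (S.height R) (Icc (0 : ℝ) 1)
    (S.Φ (R : (ℝ × ℝ) × ℝ).1)).prodMk h1
  have h3 : (fun t : ℝ => S.F ((R : (ℝ × ℝ) × ℝ).1, t)) =
      fun t => (S.Φ (R : (ℝ × ℝ) × ℝ).1, S.f (S.code R 0) t) := by
    funext t
    rw [← symbol_fst]
    rfl
  rw [centralNorm, h3]
  change ‖derivWithin _ _ (S.height R)‖ = _
  rw [h2.derivWithin (uniqueDiffOn_Icc zero_lt_one _ hx), Prod.norm_def]
  simp

theorem measurable_fiberDeriv :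
    Measurable fun R : S.Λ => fiberDeriv S.f (S.code R 0) (S.height R) := by
  have h : Measurable fun p : Fin 3 × ℝ =>
      fiberDeriv S.f p.1 (projIcc (0 : ℝ) 1 zero_le_one p.2) := by
    refine measurable_from_prod_countable_right fun i => ?_
    have : Continuous fun x : ℝ => fiberDeriv S.f i (projIcc (0 : ℝ) 1 zero_le_one x) :=
      ((S.contDiffOn i).continuousOn_derivWithin (uniqueDiffOn_Icc zero_lt_one)
        le_rfl).domRestrict.comp continuous_projIcc
    exact this.measurable
  have h' := h.comp ((S.measurable_code_apply 0).prodMk S.measurable_height)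
  convert h' using 2 with R
  simp [projIcc_of_mem _ (S.height_mem R)]

theorem integrable_log_centralNorm [IsFiniteMeasure μ] :
    Integrable (fun R : S.Λ => Real.log (S.centralNorm R)) μ := by
  simp only [centralNorm_eq]
  refine Integrable.of_bound
    (Real.measurable_log.comp measurable_fiberDeriv.norm).aestronglyMeasurable
    (|Real.log (|S.a 0|)| + |Real.log (|S.b 0|)|) (Eventually.of_forall fun R => ?_)
  -- Domination holds for every pair of indices, so the rates of leg 0 alone bound all the fiber
  -- derivatives.
  obtain ⟨h1, h2⟩ := S.dominated 0 (S.code R 0) _ (S.height_mem R)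
  have h3 := Real.log_le_log (S.contracting 0).1 h1.le
  have h4 := Real.log_le_log ((S.contracting 0).1.trans h1) h2.le
  rw [Real.norm_eq_abs, abs_le]
  constructor
  · linarith [neg_abs_le (Real.log |S.a 0|), abs_nonneg (Real.log |S.b 0|)]
  · linarith [le_abs_self (Real.log |S.b 0|), abs_nonneg (Real.log |S.a 0|)]

/-- The integrand is at most log L of the current symbol, and that symbol is uniformly distributed,
so the integral is at most the mean of log L. -/
theorem centralExponent_neg {L : Fin 3 → ℝ}
    (hL : ∀ i, ∀ x ∈ Icc (0 : ℝ) 1, |fiberDeriv S.f i x| ≤ L i)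
    (hneg : ∑ i, Real.log (L i) < 0) [IsFiniteMeasure μ]
    (hμ : μ.map S.code = bernoulliThree) : S.centralExponent μ < 0 := by
  have hg : Measurable fun i => Real.log (L i) := .of_discrete
  have hsymb : μ.map (fun R => S.code R 0) = uniformThree := by
    rw [← (measurePreserving_eval_infinitePi (fun _ : ℤ => uniformThree) 0).map_eq]
    change _ = bernoulliThree.map _
    rw [← hμ, Measure.map_map (measurable_pi_apply 0) S.measurable_code]
    rfl
  have hint : ∫ R, Real.log (L (S.code R 0)) ∂μ = (∑ i, Real.log (L i)) / 3 := by
    rw [← integral_uniformThree fun i => Real.log (L i), ← hsymb,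
      integral_map (S.measurable_code_apply 0).aemeasurable hg.aestronglyMeasurable]
  have hbd : Integrable (fun R => Real.log (L (S.code R 0))) μ := by
    have h : Integrable (fun i => Real.log (L i)) (μ.map fun R => S.code R 0) := by
      rw [hsymb]
      exact .of_finite
    exact h.comp_measurable (S.measurable_code_apply 0)
  calc S.centralExponent μ ≤ ∫ R, Real.log (L (S.code R 0)) ∂μ := by
        refine integral_mono integrable_log_centralNorm hbd fun R => ?_
        simp only [centralNorm_eq]
        exact Real.log_le_log ((S.contracting 0).1.trans
          (S.dominated 0 (S.code R 0) _ (S.height_mem R)).1) (hL _ _ (S.height_mem R))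
    _ < 0 := by
        rw [hint]
        linarith

end HorseshoeSkewProduct

theorem mainTheorem6 (S : HorseshoeSkewProduct) (γ : ℝ)
    (hF0 : CondF0 S.f) (hF1 : CondF1 S.f γ) (hF2 : CondF2 S.f) (hF01 : CondF01 S.f γ)
    (hbound : CondDerivBound S.f) (hγ : γ * betaPlus S.f ^ 2 < 1) :
    (∃! μ : Measure S.Λ, IsMeasureOfMaximalEntropy S.FΛ μ) ∧
      ∀ μ : Measure S.Λ, IsMeasureOfMaximalEntropy S.FΛ μ → S.centralExponent μ < 0 := by
  have hL := abs_fiberDeriv_le_fiberRate hF0 hF1 hF2 hbound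
  have hneg := sum_log_fiberRate_neg hF0 hF1 hγ
  obtain ⟨ν, hν, hνcode⟩ := HorseshoeSkewProduct.exists_invariant_lift hL hneg
  have := hν.1
  have hνent := HorseshoeSkewProduct.log_three_le_measureEntropy hνcode
  -- The lift ν attains log 3, so any maximizing measure has entropy at least log 3 and projects to
  -- the Bernoulli measure.
  have hcode : ∀ μ : Measure S.Λ, IsMeasureOfMaximalEntropy S.FΛ μ →
      μ.map S.code = bernoulliThree := by
    intro μ hμ
    have hle := hμ.2 ν hν
    simp only [integral_zero, EReal.coe_zero, add_zero] at hle
    exact HorseshoeSkewProduct.map_code_eq_bernoulliThree hμ.1 (hνent.trans hle)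
  refine ⟨⟨ν, ⟨hν, fun μ hμ => ?_⟩, fun μ hμ => ?_⟩, fun μ hμ => ?_⟩
  · simp only [integral_zero, EReal.coe_zero, add_zero]
    exact (HorseshoeSkewProduct.measureEntropy_le_log_three hμ).trans hνent
  · exact HorseshoeSkewProduct.eq_of_map_code_eq_bernoulliThree hL hneg (hcode μ hμ) hνcode
  · have := hμ.1.1
    exact HorseshoeSkewProduct.centralExponent_neg hL hneg (hcode μ hμ)
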